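/- Let $n\ge 2$, $k=n-1$, and $R(T)=\mathbb Z[e^{\pm a_1},\dots,e^{\pm a_n}]/(e^{a_1+\cdots+a_n}-1)$, with indices of the $a_i$ read modulo $n$, and put $b_i=1-e^{-a_i}$. Let $\hat\Lambda$ be the $R(T)$-algebra of symmetric formal power series in $y=(y_1,y_2,\dots)$ over $R(T)$ and $\Omega(b_i|y)=\prod_{j\ge1}(1-b_iy_j)^{-1}$. For $1\le i\le n-1$ let $s_i$ act on $\hat\Lambda$ by exchanging $a_i$ and $a_{i+1}$ in the coefficients, and let $s_0(f)=\frac{\Omega(b_1|y)}{\Omega(b_n|y)}s_\theta(f)$, where $s_\theta$ exchanges $a_1$ and $a_n$. Put $\alpha_i=a_i-a_{i+1}$ for $1\le i\le n-1$, $\alpha_0=a_n-a_1$, $T_i=(1-e^{\alpha_i})^{-1}(s_i-1)$ and $D_i=T_i+1$ $(0\le i\le n-1)$. For $x$ in the affine Weyl group of type $A^{(1)}_{n-1}$ with reduced expression $x=s_{i_1}\cdots s_{i_l}$ put $T_x=T_{i_1}\cdots T_{i_l}$, $D_x=D_{i_1}\cdots D_{i_l}$, $g^{(k)}_x(y|b)=T_x(1)$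 and $\tilde g^{(k)}_x(y|b)=D_x(1)$. For a partition $\lambda$ with $\lambda_1\le k$ put $g^{(k)}_\lambda=g^{(k)}_{x_\lambda}$ and $\tilde g^{(k)}_\lambda=\tilde g^{(k)}_{x_\lambda}$, where $x_\lambda$ is the product of the $s_{j-i \bmod n}$ over the boxes $(i,j)$ of $\lambda$, taken from the bottom row to the top row and from right to left in each row. Let $R_i=(i^{\,n-i})$ for $1\le i\le n$ (so $R_n=\varnothing$), and $\xi_\lambda(y)=\prod_{r=1}^{\ell(\lambda)}\Omega(b_{1-r}|y)$. Let $A$ be the $n\times n$ matrix with diagonal entries $e^{-a_1},\dots,e^{-a_n}$, entries $-1$ just above the diagonal, and $0$ elsewhere; let $P$ be the lower unitriangular matrix with entries $P_{pq}=e_{p-q}(e^{-a_1},\dots,e^{-a_{p-1}})$ for $q\le p$ (elementary symmetric polynomials). Let $\mathscr O(\tilde{\mathscr Z})$ be the $R(T)$-algebra generated by $z_{ii}^{\pm1}$ $(1\le i\le n)$ and $z_{ij}$ $(1\le i<j\le n)$ subject to the relations $AZ=ZA$ for the upper triangular matrix $Z=(z_{ij})$. Let $\tau_m$ and $\sigma_m$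 be the leading principal $m\times m$ minors of $ZAP$ and $ZP$, with $\tau_0=\sigma_0=1$. Then there is a (necessarily unique) homomorphism of $R(T)$-algebras $\beta:\mathscr O(\tilde{\mathscr Z})\to\hat\Lambda$ with $$\beta(z_{ij})=e^{a_i+\cdots+a_{j-1}}\,\Omega(b_i|y)\,g^{(k)}_{\rho_{j-i}}(y|\omega^i b)\qquad(1\le i\le j\le n),$$ where $\rho_l=s_{l-1}\cdots s_1s_0$ and $f(y|\omega^ib)$ is obtained from $f(y|b)$ by $a_j\mapsto a_{j+i}$ in the coefficients; and, for $1\le i\le n$, $$\tilde g^{(k)}_{R_i}(y|b)=\frac{\beta(\sigma_{n-i})}{\xi_{R_i}(y)},\qquad g^{(k)}_{R_i}(y|b)=e^{\sum_{s=0}^{n-i-1}a_{i-s}}\,\frac{\beta(\tau_{n-i})}{\xi_{R_i}(y)} .$$ -/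

import Mathlib

open scoped BigOperators

namespace KkSchur

noncomputable section

/-! ### The representation ring of the maximal torus of `SL_n`

Indices `1, …, n` are read in `ZMod n`, so that the index `n` is the class of `0`. -/

/-- The weight lattice `⊕ ℤ a_i / ℤ (a_1 + ⋯ + a_n)` of the maximal torus of `SL_n`. -/
abbrev Weight (n : ℕ) : Type :=
  (ZMod n → ℤ) ⧸ AddSubgroup.zmultiples (1 : ZMod n → ℤ)

/-- `R(T) = ℤ[e^{± a_1}, …, e^{± a_n}] / (e^{a_1 + ⋯ + a_n} - 1)`, the group ring of the weight
lattice. -/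
def RT (n : ℕ) : Type := AddMonoidAlgebra ℤ (Weight n)

instance (n : ℕ) : CommRing (RT n) := inferInstanceAs (CommRing (AddMonoidAlgebra ℤ (Weight n)))

variable {n : ℕ}

/-- The weight `a_i`; thus `a_0 = a_n`. -/
def wt (i : ZMod n) : Weight n := QuotientAddGroup.mk (Pi.single i 1)

/-- The element `e^μ` of `R(T)`. -/
def ex (μ : Weight n) : RT n := (AddMonoidAlgebra.single μ 1 : AddMonoidAlgebra ℤ (Weight n))

theorem ex_add (μ ν : Weight n) : ex (μ + ν) = ex μ * ex ν := by
  have h : (AddMonoidAlgebra.single μ 1 * AddMonoidAlgebra.single ν 1 :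
      AddMonoidAlgebra ℤ (Weight n)) = AddMonoidAlgebra.single (μ + ν) 1 := by
    rw [AddMonoidAlgebra.single_mul_single, one_mul]
  exact h.symm

theorem ex_zero : ex (0 : Weight n) = 1 := rfl

/-- `b_i = 1 - e^{-a_i}`. -/
def bpar (i : ZMod n) : RT n := 1 - ex (-wt i)

/-- The simple roots: `α_i = a_i - a_{i+1}` for `i ≠ 0`, and `α_0 = a_n - a_1 = -θ`. -/
def simpleRoot (i : ZMod n) : Weight n := wt i - wt (i + 1)

/-- The action of a permutation of the indices on weights, `a_j ↦ a_{w(j)}`. -/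
def permWeight (w : Equiv.Perm (ZMod n)) : Weight n →+ Weight n :=
  QuotientAddGroup.map _ _ (LinearMap.funLeft ℤ ℤ w.symm).toAddMonoidHom (by
    rw [AddSubgroup.zmultiples_le, AddSubgroup.mem_comap]
    exact AddSubgroup.mem_zmultiples (1 : ZMod n → ℤ))

theorem permWeight_wt (w : Equiv.Perm (ZMod n)) (j : ZMod n) :
    permWeight w (wt j) = wt (w j) := by
  have : (LinearMap.funLeft ℤ ℤ w.symm) (Pi.single j (1 : ℤ)) = Pi.single (w j) 1 := by
    ext t
    simp [LinearMap.funLeft_apply, Pi.single_apply, Equiv.symm_apply_eq]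
  simp only [permWeight, wt, QuotientAddGroup.map_mk]
  exact congrArg _ this

/-- The action of a permutation of the indices on `R(T)`, `e^{a_j} ↦ e^{a_{w(j)}}`. -/
def permRT (w : Equiv.Perm (ZMod n)) : RT n →+* RT n :=
  (AddMonoidAlgebra.mapDomainRingHom ℤ (permWeight w) :
    AddMonoidAlgebra ℤ (Weight n) →+* AddMonoidAlgebra ℤ (Weight n))

theorem permRT_ex (w : Equiv.Perm (ZMod n)) (μ : Weight n) :
    permRT w (ex μ) = ex (permWeight w μ) := by
  change AddMonoidAlgebra.mapDomainRingHom ℤ (permWeight w) (AddMonoidAlgebra.single μ 1) =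
    AddMonoidAlgebra.single (permWeight w μ) 1
  simp

theorem weight_torsionFree (n : ℕ) : IsAddTorsionFree (Weight n) := by
  refine ⟨fun k hk μ ν h => ?_⟩
  obtain ⟨u, rfl⟩ := QuotientAddGroup.mk_surjective μ
  obtain ⟨v, rfl⟩ := QuotientAddGroup.mk_surjective ν
  change (QuotientAddGroup.mk (k • u) : Weight n) = QuotientAddGroup.mk (k • v) at h
  rw [QuotientAddGroup.eq, AddSubgroup.mem_zmultiples_iff] at h ⊢
  obtain ⟨c, hc⟩ := h
  have hc' : ∀ t, c = k * (v t - u t) := by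
    intro t
    have := congrFun hc t
    simp at this
    linarith
  refine ⟨v 0 - u 0, ?_⟩
  ext t
  have hk' : (k : ℤ) ≠ 0 := by exact_mod_cast hk
  have := mul_left_cancel₀ hk' ((hc' 0).symm.trans (hc' t))
  simp
  linarith

instance [NeZero n] : NoZeroDivisors (RT n) := by
  have := weight_torsionFree n
  exact inferInstanceAs (NoZeroDivisors (AddMonoidAlgebra ℤ (Weight n)))

theorem one_sub_ex_simpleRoot_ne_zero [NeZero n] (hn : 2 ≤ n) (i : ZMod n) :
    1 - ex (simpleRoot i) ≠ 0 := by
  intro h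
  have h1 : (AddMonoidAlgebra.single (simpleRoot i) 1 : AddMonoidAlgebra ℤ (Weight n)) =
      AddMonoidAlgebra.single 0 1 := (sub_eq_zero.1 h).symm
  have h2 : simpleRoot i = 0 := AddMonoidAlgebra.single_left_injective one_ne_zero h1
  have : Fact (1 < n) := ⟨hn⟩
  have hne : i + 1 ≠ i := by simp
  have h3 : (QuotientAddGroup.mk (Pi.single i 1 : ZMod n → ℤ) : Weight n) =
    QuotientAddGroup.mk (Pi.single (i + 1) 1) := sub_eq_zero.1 h2
  rw [QuotientAddGroup.eq, AddSubgroup.mem_zmultiples_iff] at h3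
  obtain ⟨c, hc⟩ := h3
  have e1 := congrFun hc i
  have e2 := congrFun hc (i + 1)
  simp [hne, hne.symm] at e1 e2
  omega

/-! ### Symmetric formal power series -/

/-- The `R(T)`-algebra `Λ̂` of symmetric formal power series in `y_1, y_2, …` over `R(T)`. -/
def LambdaHat (n : ℕ) : Subalgebra (RT n) (MvPowerSeries ℕ (RT n)) where
  carrier := {f | ∀ π : Equiv.Perm ℕ, MvPowerSeries.renameEquiv (RT n) π f = f}
  mul_mem' hf hg π := by rw [map_mul, hf π, hg π]
  add_mem' hf hg π := by rw [map_add, hf π, hg π]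
  algebraMap_mem' r π := by rw [AlgEquiv.commutes]

/-- The action of a permutation of the indices on the coefficients of a symmetric power series. -/
def permLambda (w : Equiv.Perm (ZMod n)) (f : LambdaHat n) : LambdaHat n :=
  ⟨MvPowerSeries.map (permRT w) f.1, fun π => by
    have h : MvPowerSeries.rename π f.1 = f.1 := f.2 π
    change MvPowerSeries.rename π (MvPowerSeries.map (permRT w) f.1) = _
    rw [MvPowerSeries.rename_map, h]⟩

theorem coeff_renameEquiv {R : Type*} [CommRing R] (π : Equiv.Perm ℕ) (f : MvPowerSeries ℕ R)
    (m : ℕ →₀ ℕ) :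
    MvPowerSeries.coeff m (MvPowerSeries.renameEquiv R π f) =
      MvPowerSeries.coeff (m.mapDomain π.symm) f := by
  have h := MvPowerSeries.coeff_embDomain_rename π.toEmbedding f (m.mapDomain π.symm)
  rw [← h, Finsupp.embDomain_eq_mapDomain, ← Finsupp.mapDomain_comp]
  simp

/-- The power series `∏_j (1 - c y_j)⁻¹ = ∏_j (1 + c y_j + c² y_j² + ⋯)`: the coefficient of a
monomial of degree `d` is `c ^ d`. -/
def omegaSeries (c : RT n) : MvPowerSeries ℕ (RT n) := fun m => c ^ m.degree

theorem omegaSeries_mem (c : RT n) : omegaSeries c ∈ LambdaHat n := by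
  intro π
  ext1 m
  rw [coeff_renameEquiv]
  change c ^ (m.mapDomain π.symm).degree = c ^ m.degree
  congr 1
  exact Finsupp.degree_mapDomain _ _

theorem isUnit_omegaSeries (c : RT n) :
    IsUnit (⟨omegaSeries c, omegaSeries_mem c⟩ : LambdaHat n) := by
  have h0 : IsUnit (omegaSeries c) := by
    rw [MvPowerSeries.isUnit_iff_constantCoeff, ← MvPowerSeries.coeff_zero_eq_constantCoeff_apply]
    change IsUnit (c ^ (0 : ℕ →₀ ℕ).degree)
    simp
  obtain ⟨u, hu⟩ := h0
  have hmem : (↑u⁻¹ : MvPowerSeries ℕ (RT n)) ∈ LambdaHat n := by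
    intro π
    have h1 : MvPowerSeries.renameEquiv (RT n) π (u : MvPowerSeries ℕ (RT n)) = u := by
      rw [hu]; exact omegaSeries_mem c π
    have h2 := congrArg (MvPowerSeries.renameEquiv (RT n) π) u.mul_inv
    rw [map_mul, h1, map_one] at h2
    rw [← one_mul (MvPowerSeries.renameEquiv (RT n) π _), ← u.inv_mul, mul_assoc, h2, mul_one]
  refine IsUnit.of_mul_eq_one (⟨↑u⁻¹, hmem⟩ : LambdaHat n) ?_
  apply Subtype.ext
  change omegaSeries c * ↑u⁻¹ = 1
  rw [← hu, u.mul_inv]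

/-- `Ω(c|y) = ∏_j (1 - c y_j)⁻¹`, as an invertible element of `Λ̂`. -/
def Omega (c : RT n) : (LambdaHat n)ˣ := (isUnit_omegaSeries c).unit

/-! ### Demazure operators -/

/-- The action of the simple reflections on `Λ̂`: for `i ≠ 0`, `s_i` exchanges `a_i` and
`a_{i+1}`, and `s_0 f = Ω(b_1|y) Ω(b_n|y)⁻¹ s_θ(f)`, with `s_θ` exchanging `a_n` and `a_1`. -/
def simpleRefl (i : ZMod n) (f : LambdaHat n) : LambdaHat n :=
  if i = 0 then
    ((Omega (bpar (1 : ZMod n)) * (Omega (bpar (0 : ZMod n)))⁻¹ : (LambdaHat n)ˣ) : LambdaHat n) *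
      permLambda (Equiv.swap 0 1) f
  else permLambda (Equiv.swap i (i + 1)) f

theorem hom_permRT [NeZero n] {Q : Type*} [CommRing Q] (q : RT n →+* Q) (i : ZMod n)
    (hα : q (ex (simpleRoot i)) = 1) (r : RT n) :
    q (permRT (Equiv.swap i (i + 1)) r) = q r := by
  have hi : q (ex (wt i)) = q (ex (wt (i + 1))) := by
    have : wt i = simpleRoot i + wt (i + 1) := by simp [simpleRoot]
    rw [this, ex_add, map_mul, hα, one_mul]
  let S : AddSubgroup (Weight n) :=
    { carrier := {μ | q (ex (permWeight (Equiv.swap i (i + 1)) μ)) = q (ex μ)}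
      zero_mem' := by simp
      add_mem' := by
        intro μ ν hμ hν
        change q _ = q _ at hμ hν
        change q _ = q _
        rw [map_add, ex_add, ex_add, map_mul, map_mul, hμ, hν]
      neg_mem' := by
        intro μ hμ
        change q _ = q _ at hμ
        change q _ = q _
        rw [map_neg]
        have h1 : q (ex (permWeight (Equiv.swap i (i + 1)) μ)) *
            q (ex (-permWeight (Equiv.swap i (i + 1)) μ)) = 1 := by
          rw [← map_mul, ← ex_add, add_neg_cancel, ex_zero, map_one]
        have h2 : q (ex (-μ)) * q (ex μ) = 1 := by
          rw [← map_mul, ← ex_add, neg_add_cancel, ex_zero, map_one]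
        rw [hμ] at h1
        calc _ = (q (ex (-μ)) * q (ex μ)) * q (ex (-permWeight (Equiv.swap i (i + 1)) μ)) := by
              rw [h2, one_mul]
          _ = q (ex (-μ)) := by rw [mul_assoc, h1, mul_one] }
  have hwt : ∀ j, wt j ∈ S := by
    intro j
    change q (ex (permWeight _ (wt j))) = q (ex (wt j))
    rw [permWeight_wt, Equiv.swap_apply_def]
    split_ifs with h1 h2
    · rw [h1, hi]
    · rw [h2, hi]
    · rfl
  have hS : ∀ μ, μ ∈ S := by
    intro μ
    obtain ⟨v, rfl⟩ := QuotientAddGroup.mk_surjective μ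
    have hv : (QuotientAddGroup.mk v : Weight n) = ∑ j, v j • wt j := by
      have h : v = ∑ j, v j • Pi.single j (1 : ℤ) := by
        ext t
        simp [Finset.sum_apply, Pi.single_apply]
      conv_lhs => rw [h]
      change QuotientAddGroup.mk' _ (∑ j, v j • Pi.single j (1 : ℤ)) = _
      rw [map_sum]
      rfl
    rw [hv]
    exact sum_mem fun j _ => zsmul_mem (hwt j) _
  have hcomp : q.comp (permRT (Equiv.swap i (i + 1))) = q := by
    refine AddMonoidAlgebra.ringHom_ext (R := ℤ) (M := Weight n) ?_ ?_
    · intro z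
      have hz : (AddMonoidAlgebra.single 0 z : AddMonoidAlgebra ℤ (Weight n)) = ((z : RT n)) :=
        (AddMonoidAlgebra.intCast_def z).symm
      have h : q (permRT (Equiv.swap i (i + 1)) (z : RT n)) = q (z : RT n) := by
        rw [map_intCast, map_intCast]
      rw [← hz] at h
      exact h
    · intro μ
      have h := hS μ
      change q (permRT _ (ex μ)) = q (ex μ)
      rw [permRT_ex]
      exact h
  exact congrArg (fun φ : RT n →+* Q => φ r) hcomp

theorem hom_coeff_simpleRefl [NeZero n] {Q : Type*} [CommRing Q] (q : RT n →+* Q) (i : ZMod n)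
    (hα : q (ex (simpleRoot i)) = 1) (f : LambdaHat n) (m : ℕ →₀ ℕ) :
    q (MvPowerSeries.coeff m (simpleRefl i f).1) = q (MvPowerSeries.coeff m f.1) := by
  by_cases h0 : i = 0
  · subst h0
    let φ : LambdaHat n →+* MvPowerSeries ℕ Q :=
      (MvPowerSeries.map q).comp (LambdaHat n).val.toRingHom
    have hb : q (bpar (1 : ZMod n)) = q (bpar 0) := by
      have : -wt (1 : ZMod n) = -wt 0 + simpleRoot 0 := by
        rw [simpleRoot, zero_add]; abel
      rw [bpar, bpar, this, ex_add, map_sub, map_sub, map_mul, hα, mul_one]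
    have hΩ : φ (Omega (bpar (1 : ZMod n)) : LambdaHat n) =
        φ (Omega (bpar (0 : ZMod n)) : LambdaHat n) := by
      ext1 k
      change q (bpar (1 : ZMod n) ^ k.degree) = q (bpar (0 : ZMod n) ^ k.degree)
      rw [map_pow, map_pow, hb]
    have hu : φ ((Omega (bpar (1 : ZMod n)) * (Omega (bpar (0 : ZMod n)))⁻¹ :
        (LambdaHat n)ˣ) : LambdaHat n) = 1 := by
      rw [Units.val_mul, map_mul, hΩ, ← map_mul, Units.mul_inv, map_one]
    have hp : φ (permLambda (Equiv.swap 0 1) f) = φ f := by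
      ext1 k
      have := hom_permRT q 0 hα (MvPowerSeries.coeff k f.1)
      rwa [zero_add] at this
    have hfin : φ (simpleRefl 0 f) = φ f := by
      rw [simpleRefl, if_pos rfl, map_mul, hu, hp, one_mul]
    exact congrArg (MvPowerSeries.coeff m) hfin
  · rw [simpleRefl, if_neg h0]
    exact hom_permRT q i hα (MvPowerSeries.coeff m f.1)

/-- `s_i f - f` is divisible by `1 - e^{α_i}` in `Λ̂`. -/
theorem exists_demazure [NeZero n] (i : ZMod n) (f : LambdaHat n) :
    ∃ g : LambdaHat n, (1 - ex (simpleRoot i)) • g = simpleRefl i f - f := by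
  have key : ∀ m, (1 - ex (simpleRoot i)) ∣
      MvPowerSeries.coeff m (simpleRefl i f - f : LambdaHat n).1 := by
    intro m
    rw [← Ideal.mem_span_singleton]
    have h := hom_coeff_simpleRefl (Ideal.Quotient.mk (Ideal.span {1 - ex (simpleRoot i)})) i
      ((Ideal.Quotient.eq.2 (Ideal.mem_span_singleton_self _)).symm) f m
    exact Ideal.Quotient.eq.1 h
  classical
  let δ : RT n → RT n := fun c => if h : (1 - ex (simpleRoot i)) ∣ c then h.choose else 0
  have hδ : ∀ c, (1 - ex (simpleRoot i)) ∣ c → (1 - ex (simpleRoot i)) * δ c = c := by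
    intro c hc
    simp only [δ, dif_pos hc]
    exact hc.choose_spec.symm
  refine ⟨⟨fun m => δ (MvPowerSeries.coeff m (simpleRefl i f - f : LambdaHat n).1), ?_⟩, ?_⟩
  · intro π
    ext1 m
    refine (coeff_renameEquiv π _ m).trans ?_
    change δ (MvPowerSeries.coeff _ _) = δ (MvPowerSeries.coeff _ _)
    rw [← coeff_renameEquiv, (simpleRefl i f - f : LambdaHat n).2 π]
  · apply Subtype.ext
    ext1 m
    exact hδ _ (key m)

/-- The quotient of `s_i f - f` by `1 - e^{α_i}` is unique. -/
theorem demazure_unique [NeZero n] (hn : 2 ≤ n) (i : ZMod n) {g h : LambdaHat n}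
    (hgh : (1 - ex (simpleRoot i)) • g = (1 - ex (simpleRoot i)) • h) : g = h := by
  apply Subtype.ext
  ext1 m
  have := congrArg (fun f : LambdaHat n => MvPowerSeries.coeff m f.1) hgh
  exact mul_left_cancel₀ (one_sub_ex_simpleRoot_ne_zero hn i) this

/-- The Demazure operator `T_i = (1 - e^{α_i})⁻¹ (s_i - 1)` on `Λ̂`. -/
def demazureT [NeZero n] (i : ZMod n) (f : LambdaHat n) : LambdaHat n :=
  (exists_demazure i f).choose

theorem demazureT_spec [NeZero n] (i : ZMod n) (f : LambdaHat n) :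
    (1 - ex (simpleRoot i)) • demazureT i f = simpleRefl i f - f :=
  (exists_demazure i f).choose_spec

/-- The Demazure operator `D_i = T_i + 1` on `Λ̂`. -/
def demazureD [NeZero n] (i : ZMod n) (f : LambdaHat n) : LambdaHat n := demazureT i f + f

/-! ### The affine Weyl group and the `K`-theoretic double `k`-Schur functions, `k = n - 1` -/

/-- The Coxeter matrix of type `A_{n-1}^{(1)}`, with nodes `ℤ/n`: a cycle for `n ≥ 3`; for `n = 2`
the two generators satisfy no braid relation, which is encoded by the entry `0`. -/
def affineA (n : ℕ) : CoxeterMatrix (ZMod n) where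
  M := Matrix.of fun i j =>
    if i = j then 1 else if n = 2 then 0 else if j = i + 1 ∨ i = j + 1 then 3 else 2
  isSymm := by
    ext i j
    simp only [Matrix.transpose_apply, Matrix.of_apply, eq_comm (a := j) (b := i),
      or_comm (a := i = j + 1)]
  diagonal i := by simp
  off_diagonal i j h := by
    simp only [Matrix.of_apply, if_neg h]
    split_ifs <;> decide

/-- The affine Weyl group of `SL_n`, with generators `s_0, …, s_{n-1}`. -/
abbrev AffineWeyl (n : ℕ) : Type := (affineA n).Group

/-- The affine Weyl group as a Coxeter system. -/
abbrev affineSystem (n : ℕ) : CoxeterSystem (affineA n) (AffineWeyl n) :=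
  (affineA n).toCoxeterSystem

/-- A reduced word `[i_1, …, i_l]` of `x = s_{i_1} ⋯ s_{i_l}`. Since the Demazure operators satisfy
the braid relations, the operators `T_x` and `D_x` do not depend on which one is taken. -/
def reducedWord (x : AffineWeyl n) : List (ZMod n) := ((affineSystem n).exists_isReduced x).choose

/-- `T_x = T_{i_1} ⋯ T_{i_l}` for a reduced expression `x = s_{i_1} ⋯ s_{i_l}`. -/
def opT [NeZero n] (x : AffineWeyl n) (f : LambdaHat n) : LambdaHat n :=
  (reducedWord x).foldr demazureT f

/-- `D_x = D_{i_1} ⋯ D_{i_l}` for a reduced expression `x = s_{i_1} ⋯ s_{i_l}`. -/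
def opD [NeZero n] (x : AffineWeyl n) (f : LambdaHat n) : LambdaHat n :=
  (reducedWord x).foldr demazureD f

/-- The `K`-theoretic double `k`-Schur function `g_x^{(k)}(y|b) = T_x(1)`. -/
def kSchur [NeZero n] (x : AffineWeyl n) : LambdaHat n := opT x 1

/-- The closed `K`-theoretic double `k`-Schur function `g̃_x^{(k)}(y|b) = D_x(1)`. -/
def kSchurClosed [NeZero n] (x : AffineWeyl n) : LambdaHat n := opD x 1

/-- The `n`-residue `c - r` of the box in row `r` and column `c`. -/
def res (n : ℕ) (r c : ℕ) : ZMod n := (c : ZMod n) - (r : ZMod n)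

/-- The residues of the boxes of `lam`, read row by row from the bottom row to the top row, and
from right to left in each row. -/
def residueWord (n : ℕ) (lam : YoungDiagram) : List (ZMod n) :=
  (List.range (lam.colLen 0)).reverse.flatMap fun r =>
    (List.range (lam.rowLen r)).reverse.map fun c => res n r c

/-- The affine Grassmannian element `x_lam` attached to a `k`-bounded partition `lam`: the product
of the generators `s_i` along the residues of `lam`. -/
def partElt (n : ℕ) (lam : YoungDiagram) : AffineWeyl n :=
  (affineSystem n).wordProd (residueWord n lam)

/-- `g_lam^{(k)}(y|b)`. -/
def kSchurPart [NeZero n] (lam : YoungDiagram) : LambdaHat n := kSchur (partElt n lam)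

/-- `g̃_lam^{(k)}(y|b)`. -/
def kSchurClosedPart [NeZero n] (lam : YoungDiagram) : LambdaHat n :=
  kSchurClosed (partElt n lam)

/-- The `k`-rectangle `R_i = (i^{n-i})`. -/
def kRect (n i : ℕ) : YoungDiagram :=
  YoungDiagram.ofRowLens (List.replicate (n - i) i)
    (List.Pairwise.sortedGE (List.pairwise_replicate.2 (Or.inr le_rfl)))

/-- `ξ_lam(y)`, the product of the `Ω(b_res|y)` over the residues of the first column of `lam`. -/
def xi (lam : YoungDiagram) : (LambdaHat n)ˣ :=
  ∏ r ∈ Finset.range (lam.colLen 0), Omega (bpar (res n r 0))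

/-- `ρ_l = s_{l-1} ⋯ s_1 s_0`. -/
def rho (n l : ℕ) : AffineWeyl n :=
  (affineSystem n).wordProd ((List.range l).reverse.map fun t => (t : ZMod n))

/-! ### The centralizer family and the tau-functions

Matrix rows and columns `1, …, n` are indexed by `Fin n`, the element `i : Fin n` standing for
`i + 1`. -/

/-- The element `e^{-a_m}` of `R(T)`. -/
def exNeg (n m : ℕ) : RT n := ex (-wt (m : ZMod n))

/-- The upper bidiagonal matrix `A`, with diagonal `e^{-a_1}, …, e^{-a_n}` and superdiagonal
`-1`. -/
def matA (n : ℕ) : Matrix (Fin n) (Fin n) (RT n) := Matrix.of fun i j =>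
  if j = i then exNeg n ((i : ℕ) + 1) else if (j : ℕ) = (i : ℕ) + 1 then -1 else 0

/-- The elementary symmetric polynomial `e_d(e^{-a_1}, …, e^{-a_m})`. -/
def elemSymm (n m d : ℕ) : RT n := ((Multiset.range m).map fun s => exNeg n (s + 1)).esymm d

/-- The lower unitriangular matrix `P`: its entry in row `p` and column `q ≤ p` (counted from `1`)
is `e_{p-q}(e^{-a_1}, …, e^{-a_{p-1}})`. -/
def matP (n : ℕ) : Matrix (Fin n) (Fin n) (RT n) := Matrix.of fun i j =>
  if j ≤ i then elemSymm n (i : ℕ) ((i : ℕ) - (j : ℕ)) else 0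

/-- The generators `z_{ij}` (`i ≤ j`) and `z_{ii}⁻¹` of `𝒪(𝒵̃)`. -/
abbrev ZGen (n : ℕ) : Type := {p : Fin n × Fin n // p.1 ≤ p.2} ⊕ Fin n

/-- The upper triangular matrix of indeterminates. -/
def freeZ (n : ℕ) : Matrix (Fin n) (Fin n) (MvPolynomial (ZGen n) (RT n)) := Matrix.of fun i j =>
  if h : i ≤ j then MvPolynomial.X (Sum.inl ⟨(i, j), h⟩) else 0

/-- The commutator `A Z - Z A` for the matrix of indeterminates. -/
def commZ (n : ℕ) : Matrix (Fin n) (Fin n) (MvPolynomial (ZGen n) (RT n)) :=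
  (matA n).map MvPolynomial.C * freeZ n - freeZ n * (matA n).map MvPolynomial.C

/-- The ideal generated by the entries of `A Z - Z A` and by the `z_{ii} z_{ii}⁻¹ - 1`. -/
def relZ (n : ℕ) : Ideal (MvPolynomial (ZGen n) (RT n)) :=
  Ideal.span
    (Set.range (fun p : Fin n × Fin n => commZ n p.1 p.2) ∪
      Set.range fun i : Fin n => freeZ n i i * MvPolynomial.X (Sum.inr i) - 1)

/-- The coordinate ring `𝒪(𝒵̃)` of the family of invertible upper triangular matrices `Z` commuting
with `A`. -/
def OZ (n : ℕ) : Type := MvPolynomial (ZGen n) (RT n) ⧸ relZ n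

instance (n : ℕ) : CommRing (OZ n) := inferInstanceAs (CommRing (_ ⧸ relZ n))

instance (n : ℕ) : Algebra (RT n) (OZ n) := inferInstanceAs (Algebra (RT n) (_ ⧸ relZ n))

/-- The matrix `Z = (z_{ij})` of coordinate functions. -/
def matZ (n : ℕ) : Matrix (Fin n) (Fin n) (OZ n) := (freeZ n).map (Ideal.Quotient.mk (relZ n))

/-- The upper left `m × m` minor of an `n × n` matrix. -/
def leadingMinor {R : Type*} [CommRing R] (X : Matrix (Fin n) (Fin n) R) (m : ℕ) (hm : m ≤ n) : R :=
  (X.submatrix (Fin.castLE hm) (Fin.castLE hm)).det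

/-- `τ_m`, the `m`-th leading principal minor of `Z A P`. -/
def tauFun (m : ℕ) (hm : m ≤ n) : OZ n :=
  leadingMinor (matZ n * (matA n).map (algebraMap (RT n) (OZ n)) *
    (matP n).map (algebraMap (RT n) (OZ n))) m hm

/-- `σ_m`, the `m`-th leading principal minor of `Z P`. -/
def sigmaFun (m : ℕ) (hm : m ≤ n) : OZ n :=
  leadingMinor (matZ n * (matP n).map (algebraMap (RT n) (OZ n))) m hm

/-- `f(y|ω^i b)`: the substitution `a_j ↦ a_{j+i}` in the coefficients of `f(y|b)`. -/
def shiftPar (i : ZMod n) (f : LambdaHat n) : LambdaHat n := permLambda (Equiv.addRight i) f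

/-- `e^{a_i + ⋯ + a_{j-1}} Ω(b_i|y) g_{ρ_{j-i}}(y|ω^i b)`, the value on `z_{ij}` of the
homomorphism `𝒪(𝒵̃) → Λ̂`, where `1 ≤ i ≤ j ≤ n`. -/
def zImage [NeZero n] (i j : ℕ) : LambdaHat n :=
  ex (∑ t ∈ Finset.Ico i j, wt (t : ZMod n)) •
    ((Omega (bpar (i : ZMod n)) : LambdaHat n) * shiftPar (i : ZMod n) (kSchur (rho n (j - i))))

end

end KkSchur

/-! The homomorphism sends `Z` to the matrix `Ω(1 - A|y)`, whose coefficient at a monomial of degree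
`d` is `(1 - A)^d`; it commutes with `A` because each power does. The entries of these powers are
complete homogeneous polynomials in consecutive `b`'s, so the entries of `Ω(1 - A|y)` are signed
divided differences of the `Ω(b_j|y)`. The prescribed values of `z_{ij}` satisfy the same recursion,
since `ρ_{l+1} = s_l ρ_l` and `T_l` is a divided difference up to a factor (`zImage_eq_omegaEntry`).

For the rectangle put `m = n - i`. Its residues avoid the node `i = -m`. Multiplication by `ξ =
Ω(b_0) ⋯ Ω(b_{1-m})` turns every `s_j` with `j ≠ -m` into a plain exchange of indices
(`omegaProd_mul_simpleRefl`), so a finite type `A` situation remains. There the rectangle operator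
is a maximal parabolic coset representative: applied to a suitable `f` it yields an element fixed by
all finite `D_j` (`IsZeroHecke.rect_fixed`), so `ξ · D f` is invariant under all permutations of the
indices. Antisymmetrization against a staircase monomial does not see the `D_j`. Hence `ξ · D f`
times a Vandermonde determinant is a bialternant (`omegaProd_mul_foldr_mul_det`), as in the Weyl
character formula. The operators `T_j` reduce to the `D_j` by `e^{-a_{j+1}} T_j = D_j e^{-a_j}`.

On the matrix side, `P` takes the vector of powers of `-e^{-a_j}` to the values of a Newton basis,
which form an eigenvector of `A` with eigenvalue `e^{-a_j}`, hence of `Ω(1 - A|y)` with eigenvalue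
`Ω(b_j|y)`. The leading minors of `ZP` and `ZAP` times the same Vandermonde determinant are
therefore the same bialternants (`leadingMinor_mul_det`), and the determinant cancels.

Since `T_x` and `D_x` are defined by a chosen reduced word, this also needs the braid relations of
the operators, Matsumoto's theorem, and the fact that the rectangle word is reduced. -/

namespace CoxeterSystem

open List

variable {B W : Type*} [Group W] {M : CoxeterMatrix B} (cs : CoxeterSystem M W)

/-! ### The exchange property and Matsumoto's theorem. -/

section Parity

open scoped Classical in
/-- The involution `(t, ε) ↦ (s_i t s_i, ε + [t = s_i])` of `W × ℤ/2`. -/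
noncomputable def parityPerm (i : B) : Equiv.Perm (W × ZMod 2) :=
  Function.Involutive.toPerm
    (fun p => (cs.simple i * p.1 * cs.simple i, p.2 + if p.1 = cs.simple i then 1 else 0))
    (by
      rintro ⟨t, ε⟩
      have h : cs.simple i * t * cs.simple i = cs.simple i ↔ t = cs.simple i := by
        rw [mul_eq_right, mul_eq_one_iff_inv_eq, inv_simple, eq_comm]
      ext
      · simp [mul_assoc]
      · simp only [h, add_assoc]
        split_ifs <;> simp
        decide)

open scoped Classical in
theorem parityPerm_apply (i : B) (t : W) (ε : ZMod 2) :
    cs.parityPerm i (t, ε) =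
      (cs.simple i * t * cs.simple i, ε + if t = cs.simple i then 1 else 0) := rfl

-- Each further factor `s_i s_j` tests the conjugated `t` against two simple reflections. Pulled
-- back to `t`, with `r = s_i s_j`, these are tests against `r^{-2k} s_j` and `r^{-2k-1} s_j`,
-- because conjugation by `s_j` inverts `r`.
open scoped Classical in
theorem parityPerm_mul_pow_apply (i j : B) (k : ℕ) (t : W) (ε : ZMod 2) :
    ((cs.parityPerm i * cs.parityPerm j) ^ k) (t, ε) =
      ((cs.simple i * cs.simple j) ^ k * t * ((cs.simple i * cs.simple j) ^ k)⁻¹,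
        ε + ∑ c ∈ Finset.range (2 * k),
          if t = ((cs.simple i * cs.simple j) ^ c)⁻¹ * cs.simple j then 1 else 0) := by
  induction k with
  | zero => simp
  | succ k ih =>
    set r := cs.simple i * cs.simple j with hr
    have hinv : r⁻¹ = cs.simple j * cs.simple i := by simp [hr]
    have hconj : ∀ k : ℕ, cs.simple j * r ^ k = (r ^ k)⁻¹ * cs.simple j := by
      intro k
      induction k with
      | zero => simp
      | succ k ih =>
        rw [pow_succ, ← mul_assoc, ih, mul_inv_rev, ← inv_pow, mul_assoc, mul_assoc]
        have : cs.simple j * r = r⁻¹ * cs.simple j := by rw [hinv, hr, mul_assoc]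
        rw [this, ← mul_assoc, ← mul_assoc, ← pow_succ, ← pow_succ']
    have e1 : r ^ k * t * (r ^ k)⁻¹ = cs.simple j ↔ t = (r ^ (2 * k))⁻¹ * cs.simple j := by
      rw [mul_inv_eq_iff_eq_mul, ← eq_inv_mul_iff_mul_eq, hconj, ← mul_assoc, ← mul_inv_rev,
        ← pow_add, two_mul]
    have e2 : cs.simple j * (r ^ k * t * (r ^ k)⁻¹) * cs.simple j = cs.simple i ↔
        t = (r ^ (2 * k + 1))⁻¹ * cs.simple j := by
      have h1 : cs.simple j * (r ^ k * t * (r ^ k)⁻¹) * cs.simple j = cs.simple i ↔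
          r ^ k * t * (r ^ k)⁻¹ = r⁻¹ * cs.simple j := by
        rw [hinv]
        constructor
        · intro h
          rw [← h]
          simp [mul_assoc]
        · intro h
          rw [h]
          simp [mul_assoc]
      rw [h1, mul_inv_eq_iff_eq_mul, ← eq_inv_mul_iff_mul_eq, mul_assoc, hconj, ← mul_assoc,
        ← mul_assoc, ← mul_inv_rev, ← mul_inv_rev, ← pow_succ', ← pow_add]
      congr! 4
      omega
    rw [pow_succ', Equiv.Perm.mul_apply, ih, Equiv.Perm.mul_apply, parityPerm_apply,
      parityPerm_apply]
    simp only [e1, e2]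
    ext
    · simp [pow_succ', hr, mul_assoc]
    · rw [show 2 * (k + 1) = 2 * k + 1 + 1 by ring, Finset.sum_range_succ, Finset.sum_range_succ]
      simp only [add_assoc]

/-- For `k = M i j` the tested reflections `r^{-c} s_j`, `c < 2k`, repeat with period `k`, so the
contributions cancel modulo 2. -/
theorem isLiftable_parityPerm : M.IsLiftable cs.parityPerm := by
  classical
  intro i j
  ext1 ⟨t, ε⟩
  rw [parityPerm_mul_pow_apply, simple_mul_simple_pow, two_mul, Finset.sum_range_add]
  simp only [pow_add, simple_mul_simple_pow, one_mul]
  rw [CharTwo.add_self_eq_zero]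
  simp

open scoped Classical in
theorem prod_parityPerm_apply (ω : List B) (t : W) (ε : ZMod 2) :
    (ω.map cs.parityPerm).prod (t, ε) =
      (cs.wordProd ω * t * (cs.wordProd ω)⁻¹, ε + ((cs.rightInvSeq ω).count t : ZMod 2)) := by
  induction ω with
  | nil => simp
  | cons i ω ih =>
    rw [map_cons, prod_cons, Equiv.Perm.mul_apply, ih, parityPerm_apply]
    have h : cs.wordProd ω * t * (cs.wordProd ω)⁻¹ = cs.simple i ↔
        (cs.wordProd ω)⁻¹ * cs.simple i * cs.wordProd ω = t := by
      constructor
      · intro h; rw [← h]; group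
      · intro h; rw [← h]; group
    ext
    · simp [wordProd_cons, mul_assoc]
    · simp only [rightInvSeq, count_cons, h, beq_iff_eq]
      push_cast
      rw [add_assoc]

open scoped Classical in
/-- The parity of the multiplicity of `t` in the right inversion sequence of a word depends only on
the product of the word. -/
theorem count_rightInvSeq_eq {ω ω' : List B} (h : cs.wordProd ω = cs.wordProd ω') (t : W) :
    ((cs.rightInvSeq ω).count t : ZMod 2) = ((cs.rightInvSeq ω').count t : ZMod 2) := by
  have key : ∀ ω : List B, (ω.map cs.parityPerm).prod =
      cs.lift ⟨_, cs.isLiftable_parityPerm⟩ (cs.wordProd ω) := by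
    intro ω
    rw [wordProd, map_list_prod, map_map]
    congr 2
    ext1 i
    exact (cs.lift_apply_simple cs.isLiftable_parityPerm i).symm
  have h1 : (ω.map cs.parityPerm).prod (t, 0) = (ω'.map cs.parityPerm).prod (t, 0) := by
    rw [key, key, h]
  rw [prod_parityPerm_apply, prod_parityPerm_apply] at h1
  simpa using congrArg Prod.snd h1

end Parity

/-- The exchange property for right descents. -/
theorem exists_eraseIdx_of_isRightDescent {ω : List B} {i : B}
    (h : cs.IsRightDescent (cs.wordProd ω) i) :
    ∃ k < ω.length, cs.wordProd ω * cs.simple i = cs.wordProd (ω.eraseIdx k) := by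
  classical
  -- Appending `i` to a reduced word of `π(ω) s_i` gives a reduced word of `π(ω)`, whose right
  -- inversion sequence contains `s_i` exactly once. By parity `s_i` occurs in the sequence of `ω`
  -- too, and its position is the letter to erase.
  obtain ⟨ω', hω', hprod⟩ := cs.exists_isReduced (cs.wordProd ω * cs.simple i)
  have hlen : cs.IsReduced (ω' ++ [i]) := by
    rw [IsReduced, wordProd_append, wordProd_singleton, ← hprod, simple_mul_simple_cancel_right,
      length_append, length_singleton, ← hω'.eq, ← hprod]
    exact (cs.isRightDescent_iff.1 h).symm
  have hω : cs.wordProd (ω' ++ [i]) = cs.wordProd ω := by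
    rw [wordProd_append, wordProd_singleton, ← hprod, simple_mul_simple_cancel_right]
  have hmem : cs.simple i ∈ cs.rightInvSeq (ω' ++ [i]) := by
    rw [← List.concat_eq_append, rightInvSeq_concat]
    simp
  have h1 : (cs.rightInvSeq (ω' ++ [i])).count (cs.simple i) = 1 :=
    count_eq_one_of_mem hlen.nodup_rightInvSeq hmem
  have h2 := cs.count_rightInvSeq_eq hω (cs.simple i)
  rw [h1] at h2
  have hmem' : cs.simple i ∈ cs.rightInvSeq ω := by
    rw [← count_pos_iff, Nat.pos_iff_ne_zero]
    intro h0
    rw [h0] at h2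
    exact absurd h2 (by decide)
  obtain ⟨k, hk, hki⟩ := mem_iff_getElem.1 hmem'
  refine ⟨k, by simpa using hk, ?_⟩
  rw [← wordProd_mul_getD_rightInvSeq, getD_eq_getElem _ _ hk, hki]

/-- The exchange property for left descents. -/
theorem exists_eraseIdx_of_isLeftDescent {ω : List B} {i : B}
    (h : cs.IsLeftDescent (cs.wordProd ω) i) :
    ∃ k < ω.length, cs.simple i * cs.wordProd ω = cs.wordProd (ω.eraseIdx k) := by
  rw [← isRightDescent_inv_iff, ← wordProd_reverse] at h
  obtain ⟨k, hk, hprod⟩ := cs.exists_eraseIdx_of_isRightDescent h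
  have hk' : k < ω.length := by simpa using hk
  refine ⟨ω.length - 1 - k, by omega, ?_⟩
  have h2 := congrArg (·⁻¹) hprod
  simp only [mul_inv_rev, wordProd_reverse, inv_inv, inv_simple] at h2
  rw [h2, ← wordProd_reverse]
  congr 1
  rw [eraseIdx_eq_take_drop_succ, eraseIdx_eq_take_drop_succ, take_reverse, drop_reverse,
    reverse_append, reverse_reverse, reverse_reverse]
  congr 2 <;> omega

/-- A reduced expression `s_j π(ω)` with another left descent `s_i` can be rewritten to start with
`s_i s_j`. -/
theorem exists_exchange_cons (hinj : Function.Injective cs.simple) {i j : B} (hij : i ≠ j)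
    {ω : List B} (h : cs.IsLeftDescent (cs.wordProd (j :: ω)) i) :
    ∃ k < ω.length, cs.wordProd (j :: ω) = cs.wordProd (i :: j :: ω.eraseIdx k) := by
  obtain ⟨k, hk, hprod⟩ := cs.exists_eraseIdx_of_isLeftDescent h
  -- Erasing the leading `j` itself would force `s_i = s_j`.
  rcases k with _ | k
  · rw [wordProd_cons, eraseIdx_cons_zero, ← mul_assoc, mul_eq_right] at hprod
    refine absurd (hinj ?_) hij
    rw [← cs.inv_simple j]
    exact eq_inv_of_mul_eq_one_left hprod
  · refine ⟨k, by simpa using hk, ?_⟩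
    rw [cs.wordProd_cons i, ← eraseIdx_cons_succ, ← hprod, simple_mul_simple_cancel_left]

theorem IsReduced.of_cons {i : B} {ω : List B} (h : cs.IsReduced (i :: ω)) : cs.IsReduced ω := by
  simpa using h.drop 1

theorem IsReduced.isLeftDescent_cons {i : B} {ω : List B} (h : cs.IsReduced (i :: ω)) :
    cs.IsLeftDescent (cs.wordProd (i :: ω)) i := by
  have h' := h.of_cons.eq
  rw [IsLeftDescent, h.eq, wordProd_cons, simple_mul_simple_cancel_left, h', length_cons]
  exact Nat.lt_succ_self _

/-- Matsumoto's theorem for Coxeter systems all of whose braid relations have length `2` or `3`: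
elements of a monoid satisfying the braid relations have the same product along any two reduced
words of the same element. -/
theorem prod_map_eq_of_isReduced {G : Type*} [Monoid G] (f : B → G)
    (hinj : Function.Injective cs.simple)
    (hcomm : ∀ i j, cs.simple i * cs.simple j = cs.simple j * cs.simple i → f i * f j = f j * f i)
    (hbraid : ∀ i j, i ≠ j → cs.simple i * cs.simple j ≠ cs.simple j * cs.simple i →
      cs.simple i * cs.simple j * cs.simple i = cs.simple j * cs.simple i * cs.simple j ∧
        f i * f j * f i = f j * f i * f j)
    {ω ω' : List B} (hω : cs.IsReduced ω) (hω' : cs.IsReduced ω')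
    (h : cs.wordProd ω = cs.wordProd ω') : (ω.map f).prod = (ω'.map f).prod := by
  have hlen : ω.length = ω'.length := by rw [← hω.eq, ← hω'.eq, h]
  induction hN : ω.length generalizing ω ω' with
  | zero =>
    rw [List.length_eq_zero_iff.1 hN, List.length_eq_zero_iff.1 (hlen.symm.trans hN)]
  | succ N ih =>
    rcases ω with _ | ⟨i, w⟩
    · simp at hN
    rcases ω' with _ | ⟨j, w'⟩
    · simp at hlen
    -- Words with a common first letter are compared through their tails, to which the induction
    -- hypothesis applies.
    have step : ∀ {a : B} {u v : List B}, cs.IsReduced (a :: u) → (a :: u).length = N + 1 →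
        cs.wordProd (a :: u) = cs.wordProd (a :: v) → u.length = v.length →
        ((a :: u).map f).prod = ((a :: v).map f).prod := by
      intro a u v hu hl hp huv
      rw [map_cons, map_cons, prod_cons, prod_cons]
      have hp' : cs.wordProd u = cs.wordProd v := by
        rw [wordProd_cons, wordProd_cons] at hp
        exact mul_left_cancel hp
      have hv : cs.IsReduced v := by
        rw [IsReduced, ← hp', hu.of_cons.eq, huv]
      rw [ih hu.of_cons hv hp' huv (by simpa using hl)]
    by_cases hij : i = j
    · subst hij
      exact step hω hN h (by simpa using hlen)
    -- Both `i` and `j` are left descents, so exchange produces an intermediate word beginning with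
    -- `i j`, sharing its first letter with `ω`.
    obtain ⟨k, hk, hprod⟩ := cs.exists_exchange_cons hinj hij (h ▸ hω.isLeftDescent_cons)
    set u := w'.eraseIdx k with hu
    have hul : u.length + 1 = w'.length := length_eraseIdx_add_one hk
    simp only [length_cons] at hlen hN
    by_cases hc : cs.simple i * cs.simple j = cs.simple j * cs.simple i
    · have hprod' : cs.wordProd (i :: j :: u) = cs.wordProd (j :: i :: u) := by
        simp only [wordProd_cons, ← mul_assoc, hc]
      rw [step hω (by simp; omega) (h.trans hprod) (by simp; omega),
        step hω' (by simp; omega) (hprod.trans hprod') (by simp; omega)]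
      simp only [map_cons, prod_cons, ← mul_assoc, hcomm i j hc]
    · obtain ⟨hb, hbf⟩ := hbraid i j hij hc
      -- In the braid case a second exchange is needed: it exposes a word `j i j v`, which equals `i
      -- j i v` in the group. Erasing `j` instead would make `s_i` and `s_j` commute.
      have hdesc : cs.IsLeftDescent (cs.wordProd (i :: j :: u)) j := by
        rw [← hprod]
        exact hω'.isLeftDescent_cons
      obtain ⟨l, hl, hprod2⟩ := cs.exists_exchange_cons hinj (Ne.symm hij) hdesc
      rcases l with _ | l
      · refine absurd ?_ hc
        rw [eraseIdx_cons_zero] at hprod2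
        simp only [wordProd_cons, ← mul_assoc] at hprod2
        exact mul_right_cancel hprod2
      · rw [eraseIdx_cons_succ] at hprod2
        have hl' : l < u.length := by simpa using hl
        set v := u.eraseIdx l with hv
        have hvl : v.length + 1 = u.length := length_eraseIdx_add_one hl'
        have hprod3 : cs.wordProd (j :: i :: j :: v) = cs.wordProd (i :: j :: i :: v) := by
          simp only [wordProd_cons, ← mul_assoc, hb]
        rw [step hω (by simp; omega) (h.trans (hprod.trans (hprod2.trans hprod3)))
            (by simp; omega),
          step hω' (by simp; omega) (hprod.trans hprod2) (by simp; omega)]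
        simp only [map_cons, prod_cons, ← mul_assoc, hbf]

end CoxeterSystem

/-! ### Affine permutations, and Matsumoto's theorem in type `A_{n-1}^{(1)}`. -/

namespace KkSchur

variable {n : ℕ}

/-- The simple generators of the affine symmetric group, acting on `ℤ`. -/
def affineSimple (j : ZMod n) : Function.End ℤ := fun v =>
  if (v : ZMod n) = j then v + 1 else if (v : ZMod n) = j + 1 then v - 1 else v

theorem two_ne_zero_zmod (hn : 3 ≤ n) : (2 : ZMod n) ≠ 0 := by
  intro h
  have : ((2 : ℕ) : ZMod n) = 0 := by exact_mod_cast h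
  rw [ZMod.natCast_eq_zero_iff] at this
  exact absurd (Nat.le_of_dvd (by norm_num) this) (by omega)

theorem one_ne_zero_zmod (hn : 2 ≤ n) : (1 : ZMod n) ≠ 0 := by
  have : Fact (1 < n) := ⟨hn⟩
  exact one_ne_zero

theorem affineSimple_cast (j : ZMod n) (v : ℤ) :
    ((affineSimple j v : ℤ) : ZMod n) = Equiv.swap j (j + 1) (v : ZMod n) := by
  rw [affineSimple, Equiv.swap_apply_def]
  split_ifs with h1 h2
  · simp [h1]
  · simp [h2]
  · rfl

theorem affineSimple_apply (j : ZMod n) (v : ℤ) : affineSimple j v =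
    if (v : ZMod n) = j then v + 1 else if (v : ZMod n) = j + 1 then v - 1 else v := rfl

theorem affineSimple_involutive (hn : 2 ≤ n) (j : ZMod n) : affineSimple j * affineSimple j = 1 := by
  have h1 := one_ne_zero_zmod hn
  funext v
  change affineSimple j (affineSimple j v) = v
  simp only [affineSimple_apply]
  by_cases ha : (v : ZMod n) = j
  · simp [ha, h1]
  · by_cases hb : (v : ZMod n) = j + 1
    · simp [hb, h1]
    · simp [ha, hb]

theorem affineSimple_braid (hn : 3 ≤ n) (j : ZMod n) :
    affineSimple j * affineSimple (j + 1) * affineSimple j =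
      affineSimple (j + 1) * affineSimple j * affineSimple (j + 1) := by
  have h1 := one_ne_zero_zmod (n := n) (by omega)
  have h2 := two_ne_zero_zmod hn
  have h3 : (1 : ZMod n) + 1 ≠ 0 := by rwa [one_add_one_eq_two]
  funext v
  change affineSimple j (affineSimple (j + 1) (affineSimple j v)) =
    affineSimple (j + 1) (affineSimple j (affineSimple (j + 1) v))
  simp only [affineSimple_apply]
  have e1 : j + 1 + 1 ≠ j := by rwa [add_assoc, ne_eq, add_eq_left]
  by_cases ha : (v : ZMod n) = j
  · simp [ha, h1, e1, e1.symm]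
  · by_cases hb : (v : ZMod n) = j + 1
    · simp [hb, h1, e1, e1.symm]
    · by_cases hc : (v : ZMod n) = j + 1 + 1
      · simp [hc, h1, e1, e1.symm]
      · simp [ha, hb, hc]

theorem affineSimple_comm (hn : 2 ≤ n) {j k : ZMod n} (h1 : j ≠ k) (h2 : k ≠ j + 1) (h3 : j ≠ k + 1) :
    affineSimple j * affineSimple k = affineSimple k * affineSimple j := by
  funext v
  have h0 := one_ne_zero_zmod hn
  change affineSimple j (affineSimple k v) = affineSimple k (affineSimple j v)
  simp only [affineSimple_apply]
  by_cases ha : (v : ZMod n) = j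
  · simp [ha, h1, h3, h2.symm]
  · by_cases hb : (v : ZMod n) = j + 1
    · simp [hb, h0, h1, h2.symm, h3]
    · by_cases hc : (v : ZMod n) = k
      · simp [hc, h1.symm, h2, h3.symm]
      · by_cases hd : (v : ZMod n) = k + 1
        · simp [hd, h0, h1.symm, h2, h3.symm]
        · simp [ha, hb, hc, hd]

theorem affineA_apply (j k : ZMod n) : (affineA n).M j k =
    if j = k then 1 else if n = 2 then 0 else if k = j + 1 ∨ j = k + 1 then 3 else 2 := rfl

theorem pow_three_eq_one_of_braid {G : Type*} [Monoid G] {a b : G} (ha : a * a = 1)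
    (hb : b * b = 1) (h : a * b * a = b * a * b) : (a * b) ^ 3 = 1 := by
  rw [pow_succ, pow_two]
  calc a * b * (a * b) * (a * b) = (a * b * a) * (b * a * b) := by simp only [mul_assoc]
    _ = a * b * (a * a) * b * a := by rw [← h]; simp only [mul_assoc]
    _ = a * (b * b) * a := by rw [ha, mul_one]; simp only [mul_assoc]
    _ = 1 := by rw [hb, mul_one, ha]

theorem isLiftable_affineSimple (hn : 2 ≤ n) :
    (affineA n).IsLiftable (affineSimple : ZMod n → Function.End ℤ) := by
  intro j k
  rw [affineA_apply]
  split_ifs with h1 h2 h3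
  · rw [h1, pow_one, affineSimple_involutive hn]
  · rw [pow_zero]
  · have h4 : affineSimple j * affineSimple k * affineSimple j =
        affineSimple k * affineSimple j * affineSimple k := by
      rcases h3 with rfl | rfl
      · exact affineSimple_braid (by omega) j
      · exact (affineSimple_braid (by omega) k).symm
    exact pow_three_eq_one_of_braid (affineSimple_involutive hn j) (affineSimple_involutive hn k) h4
  · push Not at h3
    rw [pow_two]
    nth_rw 2 [affineSimple_comm hn h1 h3.1 h3.2]
    rw [mul_assoc, ← mul_assoc (affineSimple k), affineSimple_involutive hn, one_mul,
      affineSimple_involutive hn]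

/-- The action of the affine Weyl group on `ℤ` by affine permutations. -/
noncomputable def affinePerm (hn : 2 ≤ n) : AffineWeyl n →* Function.End ℤ :=
  (affineSystem n).lift ⟨affineSimple, isLiftable_affineSimple hn⟩

theorem affinePerm_simple (hn : 2 ≤ n) (j : ZMod n) :
    affinePerm hn ((affineSystem n).simple j) = affineSimple j :=
  (affineSystem n).lift_apply_simple (isLiftable_affineSimple hn) j

theorem affinePerm_wordProd (hn : 2 ≤ n) (ω : List (ZMod n)) :
    affinePerm hn ((affineSystem n).wordProd ω) = (ω.map affineSimple).prod := by
  rw [CoxeterSystem.wordProd, map_list_prod, List.map_map]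
  congr 2

/-- On a lift `v` of `j` the two products take the values `v + 1` and `v + 2`. -/
theorem affineSimple_ne_comm (hn : 3 ≤ n) (j : ZMod n) :
    affineSimple j * affineSimple (j + 1) ≠ affineSimple (j + 1) * affineSimple j := by
  have h1 := one_ne_zero_zmod (n := n) (by omega)
  have h3 : (1 : ZMod n) + 1 ≠ 0 := by rw [one_add_one_eq_two]; exact two_ne_zero_zmod hn
  intro h
  obtain ⟨v, hv⟩ := ZMod.intCast_surjective j
  have h4 : affineSimple j (affineSimple (j + 1) v) = affineSimple (j + 1) (affineSimple j v) :=
    congrFun h v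
  simp [affineSimple_apply, hv, add_assoc, h1, h3] at h4

theorem simple_injective (hn : 2 ≤ n) : Function.Injective (affineSystem n).simple := by
  have h1 := one_ne_zero_zmod hn
  intro j k h
  have h2 := congrArg (affinePerm hn) h
  rw [affinePerm_simple, affinePerm_simple] at h2
  obtain ⟨v, hv⟩ := ZMod.intCast_surjective j
  have h3 : affineSimple j v = affineSimple k v := congrFun h2 v
  simp only [affineSimple_apply, hv, if_true] at h3
  split_ifs at h3 with h4 h5
  · exact h4
  · omega
  · omega

/-- Matsumoto's theorem for the affine Weyl group of type `A_{n-1}^{(1)}`, `n ≥ 3`. -/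
theorem prod_map_eq_of_isReduced {G : Type*} [Monoid G] (hn : 3 ≤ n) (f : ZMod n → G)
    (hcomm : ∀ j k, j ≠ k → k ≠ j + 1 → j ≠ k + 1 → f j * f k = f k * f j)
    (hbraid : ∀ j, f j * f (j + 1) * f j = f (j + 1) * f j * f (j + 1))
    {ω ω' : List (ZMod n)} (hω : (affineSystem n).IsReduced ω) (hω' : (affineSystem n).IsReduced ω')
    (h : (affineSystem n).wordProd ω = (affineSystem n).wordProd ω') :
    (ω.map f).prod = (ω'.map f).prod := by
  have hn2 : 2 ≤ n := by omega
  have hsimple : ∀ j k, j ≠ k → k ≠ j + 1 → j ≠ k + 1 →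
      (affineSystem n).simple j * (affineSystem n).simple k =
        (affineSystem n).simple k * (affineSystem n).simple j := by
    intro j k h1 h2 h3
    have h4 := (affineSystem n).simple_mul_simple_pow j k
    rw [affineA_apply, if_neg h1, if_neg (by omega), if_neg (by tauto), pow_two] at h4
    have h5 := eq_inv_of_mul_eq_one_left h4
    rw [h5, mul_inv_rev, CoxeterSystem.inv_simple, CoxeterSystem.inv_simple]
  have hne : ∀ j, (affineSystem n).simple j * (affineSystem n).simple (j + 1) ≠
        (affineSystem n).simple (j + 1) * (affineSystem n).simple j := by
    intro j h1
    have h2 := congrArg (affinePerm hn2) h1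
    rw [map_mul, map_mul, affinePerm_simple, affinePerm_simple] at h2
    exact affineSimple_ne_comm hn j h2
  have hb : ∀ j, (affineSystem n).simple j * (affineSystem n).simple (j + 1) *
      (affineSystem n).simple j = (affineSystem n).simple (j + 1) * (affineSystem n).simple j *
        (affineSystem n).simple (j + 1) := by
    intro j
    have h1 : j ≠ j + 1 := by simpa using one_ne_zero_zmod hn2
    have h4 := (affineSystem n).simple_mul_simple_pow j (j + 1)
    rw [affineA_apply, if_neg h1, if_neg (by omega), if_pos (Or.inl rfl), pow_succ, pow_two] at h4
    have h5 := eq_inv_of_mul_eq_one_left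
      (show (affineSystem n).simple j * (affineSystem n).simple (j + 1) *
        (affineSystem n).simple j * ((affineSystem n).simple (j + 1) * (affineSystem n).simple j *
        (affineSystem n).simple (j + 1)) = 1 from Eq.trans (by simp only [mul_assoc]) h4)
    rw [h5]
    simp only [mul_inv_rev, CoxeterSystem.inv_simple, mul_assoc]
  refine (affineSystem n).prod_map_eq_of_isReduced f (simple_injective hn2) ?_ ?_ hω hω' h
  · intro j k hjk
    by_cases h1 : j = k
    · rw [h1]
    by_cases h2 : k = j + 1
    · subst h2
      exact absurd hjk (hne j)
    by_cases h3 : j = k + 1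
    · subst h3
      exact absurd hjk.symm (hne k)
    exact hcomm j k h1 h2 h3
  · intro j k h1 hjk
    by_cases h2 : k = j + 1
    · subst h2
      exact ⟨hb j, hbraid j⟩
    by_cases h3 : j = k + 1
    · subst h3
      exact ⟨(hb k).symm, (hbraid k).symm⟩
    exact absurd (hsimple j k h1 h2 h3) hjk

/-! ### The word of a rectangle is reduced. -/

theorem affineSimple_intCast {a v : ℤ} (h1 : |v - a| < n) (h2 : |v - (a + 1)| < n) :
    affineSimple (a : ZMod n) v = if v = a then v + 1 else if v = a + 1 then v - 1 else v := by
  have key : ∀ b : ℤ, |v - b| < n → ((v : ZMod n) = (b : ZMod n) ↔ v = b) := by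
    intro b hb
    constructor
    · intro h
      rw [ZMod.intCast_eq_intCast_iff_dvd_sub] at h
      rw [abs_sub_comm] at hb
      have := Int.eq_zero_of_abs_lt_dvd h hb
      omega
    · rintro rfl; rfl
  have h3 : ((a : ZMod n) + 1) = ((a + 1 : ℤ) : ZMod n) := by push_cast; rfl
  simp only [affineSimple_apply, h3, key a h1, key (a + 1) h2]

theorem affineSimple_add_natCast (j : ZMod n) (v : ℤ) :
    affineSimple j (v + n) = affineSimple j v + n := by
  have h : ((v + n : ℤ) : ZMod n) = (v : ZMod n) := by simp
  simp only [affineSimple_apply, h]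
  split_ifs <;> ring

theorem prod_affineSimple_add_natCast (ω : List (ZMod n)) (v : ℤ) :
    (ω.map affineSimple).prod (v + n) = (ω.map affineSimple).prod v + n := by
  induction ω with
  | nil => rfl
  | cons j ω ih =>
    rw [List.map_cons, List.prod_cons]
    change affineSimple j ((ω.map affineSimple).prod (v + n)) =
      affineSimple j ((ω.map affineSimple).prod v) + n
    rw [ih, affineSimple_add_natCast]

/-- Used as injectivity on residues: integers less than `n` apart that acquire congruent images are
equal. -/
theorem exists_perm_prod_affineSimple (ω : List (ZMod n)) : ∃ σ : Equiv.Perm (ZMod n), ∀ v : ℤ,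
    (((ω.map affineSimple).prod v : ℤ) : ZMod n) = σ (v : ZMod n) := by
  induction ω with
  | nil => exact ⟨1, fun v => rfl⟩
  | cons j ω ih =>
    obtain ⟨σ, hσ⟩ := ih
    refine ⟨Equiv.swap j (j + 1) * σ, fun v => ?_⟩
    rw [List.map_cons, List.prod_cons, Equiv.Perm.mul_apply, ← hσ]
    exact affineSimple_cast _ _

theorem succ_ediv_le {d N : ℤ} (hN : 0 < N) (h : ¬ N ∣ d + 1) : (d + 1) / N ≤ d / N := by
  rw [Int.le_ediv_iff_mul_le hN]
  have h1 : (d + 1) / N * N ≤ d + 1 := Int.ediv_mul_le _ hN.ne'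
  have h2 : (d + 1) / N * N ≠ d + 1 := fun h2 => h (Dvd.intro_left _ h2)
  omega

/-- If the difference grows by one, the floor jumps only when the new difference is a multiple of
`n`; this would require `d ≡ j` and `k ≡ j + 1` simultaneously, in which case the difference grows
by two. -/
theorem ediv_affineSimple_le (hn : 2 ≤ n) (j : ZMod n) {d k : ℤ} (hdk : (d : ZMod n) ≠ k) :
    (affineSimple j d - affineSimple j k) / (n : ℤ) ≤
      (d - k) / n + if (d : ZMod n) = j ∧ (k : ZMod n) = j + 1 then 1 else 0 := by
  have hN : (0 : ℤ) < n := by omega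
  have h0 := one_ne_zero_zmod hn
  have hdvd : ∀ e : ℤ, (n : ℤ) ∣ e ↔ (e : ZMod n) = 0 := fun e =>
    (ZMod.intCast_zmod_eq_zero_iff_dvd e n).symm
  have mono : ∀ {a b : ℤ}, a ≤ b → a / (n : ℤ) ≤ b / n := fun h => Int.ediv_le_ediv hN h
  by_cases h1 : (d : ZMod n) = j
  · have e1 : affineSimple j d = d + 1 := by rw [affineSimple_apply, if_pos h1]
    by_cases h2 : (k : ZMod n) = j + 1
    · have e2 : affineSimple j k = k - 1 := by
        rw [affineSimple_apply, h2, if_neg (by simpa using h0), if_pos rfl]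
      rw [e1, e2, if_pos ⟨h1, h2⟩]
      calc (d + 1 - (k - 1)) / (n : ℤ) ≤ (d - k + n * 1) / n := mono (by omega)
        _ = (d - k) / n + 1 := Int.add_mul_ediv_left _ _ hN.ne'
    · have e2 : affineSimple j k = k := by
        rw [affineSimple_apply, if_neg (fun h => hdk (h1.trans h.symm)), if_neg h2]
      rw [e1, e2, if_neg (fun h => h2 h.2), add_zero]
      have := succ_ediv_le (d := d - k) hN (by
        rw [hdvd]; push_cast; rw [h1, sub_add_eq_add_sub, sub_eq_zero]; exact Ne.symm h2)
      rwa [sub_add_eq_add_sub] at this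
  · rw [if_neg (fun h => h1 h.1), add_zero]
    by_cases h2 : (k : ZMod n) = j + 1
    · have e2 : affineSimple j k = k - 1 := by
        rw [affineSimple_apply, h2, if_neg (by simpa using h0), if_pos rfl]
      have e1 : affineSimple j d = d := by
        rw [affineSimple_apply, if_neg h1, if_neg (fun h => hdk (h.trans h2.symm))]
      rw [e1, e2]
      have := succ_ediv_le (d := d - k) hN (by
        rw [hdvd]; push_cast; rw [h2, sub_add, add_sub_cancel_right, sub_eq_zero]; exact h1)
      rwa [show d - (k - 1) = d - k + 1 by ring]
    · have e1 : affineSimple j d ≤ d := by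
        rw [affineSimple_apply, if_neg h1]
        split_ifs <;> omega
      have e2 : k ≤ affineSimple j k := by
        rw [affineSimple_apply, if_neg h2]
        split_ifs <;> omega
      exact mono (by omega)

/-- A signed count of the inversions of an affine permutation between the blocks `[1, i]` and
`[i + 1, n]`. -/
noncomputable def blockInv (n i : ℕ) (g : ℤ → ℤ) : ℤ :=
  ∑ p ∈ Finset.Icc (1 : ℤ) i ×ˢ Finset.Icc ((i : ℤ) + 1) n, (g p.2 - g p.1) / (n : ℤ)

/-- A further letter `j` raises the sum by at most one, because at most one pair of positions has
images in the classes `j + 1` and `j`. This bounds the length of any word from below. -/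
theorem blockInv_prod_affineSimple_le (hn : 2 ≤ n) (i : ℕ) (ω : List (ZMod n)) :
    blockInv n i (ω.map affineSimple).prod ≤ ω.length := by
  induction ω with
  | nil =>
    refine (Finset.sum_eq_zero fun p hp => ?_).le
    rw [Finset.mem_product, Finset.mem_Icc, Finset.mem_Icc] at hp
    exact Int.ediv_eq_zero_of_lt (by change 0 ≤ p.2 - p.1; omega)
      (by change p.2 - p.1 < n; omega)
  | cons j ω ih =>
    obtain ⟨σ, hσ⟩ := exists_perm_prod_affineSimple ω
    rw [List.map_cons, List.prod_cons]
    set g : Function.End ℤ := (ω.map affineSimple).prod with hg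
    have hinj : ∀ v w : ℤ, ((g v : ℤ) : ZMod n) = ((g w : ℤ) : ZMod n) → |v - w| < n → v = w := by
      intro v w h1 h2
      rw [hσ, hσ] at h1
      have h3 := σ.injective h1
      rw [ZMod.intCast_eq_intCast_iff_dvd_sub] at h3
      rw [abs_sub_comm] at h2
      have := Int.eq_zero_of_abs_lt_dvd h3 h2
      omega
    have h1 : blockInv n i (affineSimple j * g : Function.End ℤ) ≤ blockInv n i g +
        ∑ p ∈ Finset.Icc (1 : ℤ) i ×ˢ Finset.Icc ((i : ℤ) + 1) n,
          if ((g p.2 : ℤ) : ZMod n) = j ∧ ((g p.1 : ℤ) : ZMod n) = j + 1 then (1 : ℤ) else 0 := by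
      simp only [blockInv]
      rw [← Finset.sum_add_distrib]
      refine Finset.sum_le_sum fun p hp => ediv_affineSimple_le hn j ?_
      rw [Finset.mem_product, Finset.mem_Icc, Finset.mem_Icc] at hp
      intro h
      have := hinj _ _ h (by rw [abs_lt]; omega)
      omega
    have h2 : (∑ p ∈ Finset.Icc (1 : ℤ) i ×ˢ Finset.Icc ((i : ℤ) + 1) n,
          if ((g p.2 : ℤ) : ZMod n) = j ∧ ((g p.1 : ℤ) : ZMod n) = j + 1 then (1 : ℤ) else 0) ≤ 1 := by
      rw [Finset.sum_boole]
      norm_cast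
      rw [Finset.card_le_one]
      intro p hp q hq
      simp only [Finset.mem_filter, Finset.mem_product, Finset.mem_Icc] at hp hq
      ext
      · exact hinj _ _ (hp.2.2.trans hq.2.2.symm) (by rw [abs_lt]; omega)
      · exact hinj _ _ (hp.2.1.trans hq.2.1.symm) (by rw [abs_lt]; omega)
    rw [List.length_cons]
    push_cast
    linarith

/-- The residues of the boxes of the rectangle with `m` rows of length `i`. -/
def rectWord (n i m : ℕ) : List (ZMod n) :=
  (List.range m).reverse.flatMap fun r => (List.range i).reverse.map fun c => res n r c

theorem rectWord_succ (i m : ℕ) : rectWord n i (m + 1) =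
    ((List.range i).reverse.map fun c => res n m c) ++ rectWord n i m := by
  simp [rectWord, List.range_succ]

theorem length_rectWord (i m : ℕ) : (rectWord n i m).length = m * i := by
  induction m with
  | zero => simp [rectWord]
  | succ m ih => rw [rectWord_succ, List.length_append, ih]; simp; ring

/-- A row acts on the window `[-r, n - r)` as the cycle moving `-r` to `c - r` and the values jumped
over one step down. -/
theorem prod_affineSimple_row {r c : ℕ} (hc : c < n) {v : ℤ} (h1 : -(r : ℤ) ≤ v)
    (h2 : v < (n : ℤ) - r) :
    (((List.range c).reverse.map fun c => res n r c).map affineSimple).prod v =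
      if v = -r then (c : ℤ) - r else if v ≤ (c : ℤ) - r then v - 1 else v := by
  induction c with
  | zero =>
    change v = _
    split_ifs <;> omega
  | succ c ih =>
    rw [List.range_succ, List.reverse_append, List.reverse_singleton, List.singleton_append,
      List.map_cons, List.map_cons, List.prod_cons]
    change affineSimple (res n r c) ((((List.range c).reverse.map fun c => res n r c).map
      affineSimple).prod v) = _
    rw [ih (by omega), show res n r c = (((c : ℤ) - r : ℤ) : ZMod n) by simp [res]]
    rw [affineSimple_intCast]
    · push_cast
      split_ifs <;> omega
    · rw [abs_lt]
      split_ifs <;> omega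
    · rw [abs_lt]
      split_ifs <;> omega

/-- The rectangle interchanges the adjacent blocks `(-m, 0]` and `[1, i]`; each new row enlarges the
lower block by one element. -/
theorem prod_affineSimple_rectWord {i m : ℕ} (hi : 1 ≤ i) (him : i + m ≤ n) {v : ℤ}
    (h1 : (i : ℤ) - n < v) (h2 : v ≤ i) :
    ((rectWord n i m).map affineSimple).prod v =
      if 1 ≤ v then v - m else if -(m : ℤ) < v then v + i else v := by
  induction m with
  | zero =>
    change v = _
    push_cast
    split_ifs <;> omega
  | succ m ih =>
    rw [rectWord_succ, List.map_append, List.prod_append]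
    change (((List.range i).reverse.map fun c => res n m c).map affineSimple).prod
      (((rectWord n i m).map affineSimple).prod v) = _
    rw [ih (by omega)]
    by_cases h3 : -(m : ℤ) ≤ v
    · rw [prod_affineSimple_row (by omega)]
      · push_cast
        split_ifs <;> omega
      · split_ifs <;> omega
      · split_ifs <;> omega
    -- Here `v < -m` lies below the window of the row formula, which is applied at `v + n` instead.
    · rw [if_neg (by omega), if_neg (by omega), if_neg (by omega), if_neg (by push_cast; omega)]
      have h4 := prod_affineSimple_add_natCast ((List.range i).reverse.map fun c => res n m c) v
      rw [prod_affineSimple_row (by omega) (by omega) (by omega), if_neg (by omega),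
        if_neg (by omega)] at h4
      linarith

/-- Each of the `i m` pairs of positions contributes exactly one to `blockInv`, so no word of the
same element has fewer than `i m` letters. -/
theorem isReduced_rectWord (hn : 2 ≤ n) {i m : ℕ} (hi : 1 ≤ i) (him : i + m = n) :
    (affineSystem n).IsReduced (rectWord n i m) := by
  refine le_antisymm ((affineSystem n).length_wordProd_le _) ?_
  obtain ⟨ω, hω, hprod⟩ := (affineSystem n).exists_isReduced ((affineSystem n).wordProd
    (rectWord n i m))
  rw [hprod, hω.eq]
  have h1 := blockInv_prod_affineSimple_le hn i ω
  rw [← affinePerm_wordProd hn, ← hprod, affinePerm_wordProd] at h1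
  have h2 : blockInv n i ((rectWord n i m).map affineSimple).prod = m * i := by
    have h3 : ∀ p ∈ Finset.Icc (1 : ℤ) i ×ˢ Finset.Icc ((i : ℤ) + 1) n,
        (((rectWord n i m).map affineSimple).prod p.2 -
          ((rectWord n i m).map affineSimple).prod p.1) / (n : ℤ) = 1 := by
      intro p hp
      rw [Finset.mem_product, Finset.mem_Icc, Finset.mem_Icc] at hp
      -- The position `p.2` lies in `[i + 1, n]`; translation by `-n` brings it into the block `(-m,
      -- 0]`.
      have h4 := prod_affineSimple_add_natCast (rectWord n i m) (p.2 - n)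
      rw [sub_add_cancel, prod_affineSimple_rectWord (v := p.2 - n) hi him.le (by omega) (by omega),
        if_neg (by omega), if_pos (by omega)] at h4
      rw [h4, prod_affineSimple_rectWord (v := p.1) hi him.le (by omega) (by omega), if_pos (by omega)]
      rw [show p.2 - n + i + n - (p.1 - m) = (p.2 - p.1) + n * 1 by
        rw [← him]; push_cast; ring, Int.add_mul_ediv_left _ _ (by omega),
        Int.ediv_eq_zero_of_lt (by omega) (by omega), zero_add]
    simp only [blockInv]
    rw [Finset.sum_congr rfl h3, Finset.sum_const, Finset.card_product, Int.card_Icc,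
      Int.card_Icc, nsmul_one]
    have : ((i : ℤ) + 1 - 1).toNat * ((n : ℤ) + 1 - (i + 1)).toNat = i * m := by
      congr 1 <;> omega
    rw [this]
    push_cast
    ring
  rw [h2] at h1
  rw [length_rectWord]
  exact_mod_cast h1

theorem colLen_kRect {i : ℕ} (hi : 1 ≤ i) : (kRect n i).colLen 0 = n - i := by
  rw [← YoungDiagram.length_rowLens, kRect, YoungDiagram.rowLens_ofRowLens_eq_self]
  · simp
  · intro x hx
    rw [List.eq_of_mem_replicate hx]
    exact hi

theorem rowLen_kRect {i r : ℕ} (hr : r < n - i) : (kRect n i).rowLen r = i := by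
  have := YoungDiagram.rowLen_ofRowLens (w := List.replicate (n - i) i)
    (hw := List.Pairwise.sortedGE (List.pairwise_replicate.2 (Or.inr le_rfl))) ⟨r, by simpa using hr⟩
  exact this.trans (by simp)

theorem residueWord_kRect {i : ℕ} (hi : 1 ≤ i) :
    residueWord n (kRect n i) = rectWord n i (n - i) := by
  rw [residueWord, rectWord, colLen_kRect hi]
  refine List.flatMap_congr fun r hr => ?_
  rw [rowLen_kRect (by simpa using hr)]

end KkSchur

/-! ### Demazure operators in a ring without zero divisors, given by `(x - y) D f = x s(f) - y f`.
-/

section DemazureAlgebra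

variable {B : Type*} [CommRing B] [NoZeroDivisors B]

/-- Both `x - y` and `x s(f) - y f` change sign under `s`. -/
theorem demazure_fixed {x y : B} (hxy : x ≠ y) (s : B →+ B) {D : B → B}
    (sx : ∀ f, s (x * f) = y * s f) (sy : ∀ f, s (y * f) = x * s f) (ss : ∀ f, s (s f) = f)
    (hD : ∀ f, (x - y) * D f = x * s f - y * f) (f : B) : s (D f) = D f := by
  have h1 := hD f
  have h2 := congrArg s h1
  rw [sub_mul, map_sub, map_sub, sx, sy, sx, sy, ss] at h2
  exact mul_left_cancel₀ (sub_ne_zero.2 hxy) (by linear_combination -h1 - h2)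

theorem demazure_eq_self {x y : B} (hxy : x ≠ y) (s : B →+ B) {D : B → B}
    (hD : ∀ f, (x - y) * D f = x * s f - y * f) {f : B} (hf : s f = f) : D f = f :=
  mul_left_cancel₀ (sub_ne_zero.2 hxy) (by rw [hD, hf, sub_mul])

theorem demazure_comm {x y z w : B} (hxy : x ≠ y) (hzw : z ≠ w) (s t : B →+ B) {D E : B → B}
    (sz : ∀ f, s (z * f) = z * s f) (sw : ∀ f, s (w * f) = w * s f)
    (tx : ∀ f, t (x * f) = x * t f) (ty : ∀ f, t (y * f) = y * t f)
    (st : ∀ f, s (t f) = t (s f))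
    (hD : ∀ f, (x - y) * D f = x * s f - y * f) (hE : ∀ f, (z - w) * E f = z * t f - w * f)
    (f : B) : D (E f) = E (D f) := by
  have h1 := hD (E f)
  have h2 := hE f
  have h3 := congrArg s h2
  rw [sub_mul, map_sub, map_sub, sz, sw, sz, sw] at h3
  have k1 := hE (D f)
  have k2 := hD f
  have k3 := congrArg t k2
  rw [sub_mul, map_sub, map_sub, tx, ty, tx, ty] at k3
  refine mul_left_cancel₀ (mul_ne_zero (sub_ne_zero.2 hxy) (sub_ne_zero.2 hzw)) ?_
  rw [st] at h3
  linear_combination (z - w) * h1 + x * h3 - y * h2 - (x - y) * k1 - z * k3 + w * k2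

/-- Multiplied by `(x - y)(y - z)(x - z)`, both sides become the same combination of the six images
of `f` under the group generated by `s` and `t`. The facts `a0` and `b0` keep the expansions short.
-/
theorem demazure_braid {x y z : B} (hxy : x ≠ y) (hyz : y ≠ z) (hxz : x ≠ z) (s t : B →+ B)
    {D E : B → B}
    (sx : ∀ f, s (x * f) = y * s f) (sy : ∀ f, s (y * f) = x * s f)
    (sz : ∀ f, s (z * f) = z * s f) (ss : ∀ f, s (s f) = f)
    (tx : ∀ f, t (x * f) = x * t f) (ty : ∀ f, t (y * f) = z * t f)
    (tz : ∀ f, t (z * f) = y * t f) (tt : ∀ f, t (t f) = f)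
    (st : ∀ f, s (t (s f)) = t (s (t f)))
    (hD : ∀ f, (x - y) * D f = x * s f - y * f) (hE : ∀ f, (y - z) * E f = y * t f - z * f)
    (f : B) : D (E (D f)) = E (D (E f)) := by
  have a0 := demazure_fixed hxy s sx sy ss hD f
  have a1 := hD f
  have a2 := hE (D f)
  have a3 := hD (E (D f))
  have a4 := congrArg t a1
  rw [sub_mul, map_sub, map_sub, tx, ty, tx, ty] at a4
  have a5 := congrArg s a2
  rw [sub_mul, map_sub, map_sub, sy, sz, sy, sz, a0] at a5
  have a6 := congrArg s a4
  rw [map_sub, map_sub, sx, sz, sx, sz] at a6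
  have b0 := demazure_fixed hyz t ty tz tt hE f
  have b1 := hE f
  have b2 := hD (E f)
  have b3 := hE (D (E f))
  have b4 := congrArg s b1
  rw [sub_mul, map_sub, map_sub, sy, sz, sy, sz] at b4
  have b5 := congrArg t b2
  rw [sub_mul, map_sub, map_sub, tx, ty, tx, ty, b0] at b5
  have b6 := congrArg t b4
  rw [map_sub, map_sub, tx, tz, tx, tz] at b6
  rw [st] at a6
  refine mul_left_cancel₀ (mul_ne_zero (mul_ne_zero (sub_ne_zero.2 hxy) (sub_ne_zero.2 hyz))
    (sub_ne_zero.2 hxz)) ?_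
  linear_combination (y - z) * (x - z) * a3 + x * (y - z) * a5 - y * (x - z) * a2 + x * x * a6
    - y * y * a4 + z * z * a1
    - ((x - y) * (x - z) * b3 + y * (x - y) * b5 - z * (x - z) * b2 + x * y * b6
    - x * z * b4 + y * z * b1)

end DemazureAlgebra

/-! ### The reflections and Demazure operators on `Λ̂`. -/

namespace KkSchur

variable {n : ℕ}

theorem permWeight_mul (w w' : Equiv.Perm (ZMod n)) (μ : Weight n) :
    permWeight (w * w') μ = permWeight w (permWeight w' μ) := by
  obtain ⟨v, rfl⟩ := QuotientAddGroup.mk_surjective μ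
  rfl

theorem permWeight_one (μ : Weight n) : permWeight (1 : Equiv.Perm (ZMod n)) μ = μ := by
  obtain ⟨v, rfl⟩ := QuotientAddGroup.mk_surjective μ
  rfl

theorem RT_hom_ext {S : Type*} [CommRing S] {φ ψ : RT n →+* S} (h : ∀ μ, φ (ex μ) = ψ (ex μ)) :
    φ = ψ := by
  refine AddMonoidAlgebra.ringHom_ext (R := ℤ) (M := Weight n) (fun z => ?_) h
  have hz : (AddMonoidAlgebra.single 0 z : AddMonoidAlgebra ℤ (Weight n)) = ((z : RT n)) :=
    (AddMonoidAlgebra.intCast_def z).symm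
  have : φ (z : RT n) = ψ (z : RT n) := by rw [map_intCast, map_intCast]
  rw [← hz] at this
  exact this

theorem permRT_mul (w w' : Equiv.Perm (ZMod n)) (r : RT n) :
    permRT (w * w') r = permRT w (permRT w' r) := by
  have : permRT (w * w') = (permRT w).comp (permRT w') :=
    RT_hom_ext fun μ => by
      rw [RingHom.comp_apply, permRT_ex, permRT_ex, permRT_ex, permWeight_mul]
  rw [this, RingHom.comp_apply]

theorem permRT_one (r : RT n) : permRT (1 : Equiv.Perm (ZMod n)) r = r := by
  have : permRT (1 : Equiv.Perm (ZMod n)) = RingHom.id _ :=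
    RT_hom_ext fun μ => by rw [permRT_ex, permWeight_one, RingHom.id_apply]
  rw [this, RingHom.id_apply]

/-- The action of a permutation of the indices on `Λ̂`, as a ring homomorphism. -/
noncomputable def permHom (w : Equiv.Perm (ZMod n)) : LambdaHat n →+* LambdaHat n where
  toFun := permLambda w
  map_one' := Subtype.ext (map_one (MvPowerSeries.map (permRT w)))
  map_zero' := Subtype.ext (map_zero (MvPowerSeries.map (permRT w)))
  map_mul' f g := Subtype.ext (map_mul (MvPowerSeries.map (permRT w)) f.1 g.1)
  map_add' f g := Subtype.ext (map_add (MvPowerSeries.map (permRT w)) f.1 g.1)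

theorem permHom_apply (w : Equiv.Perm (ZMod n)) (f : LambdaHat n) :
    permHom w f = permLambda w f := rfl

theorem lambdaHat_ext {f g : LambdaHat n}
    (h : ∀ m, MvPowerSeries.coeff m f.1 = MvPowerSeries.coeff m g.1) : f = g :=
  Subtype.ext (MvPowerSeries.ext h)

theorem permHom_mul (w w' : Equiv.Perm (ZMod n)) (f : LambdaHat n) :
    permHom (w * w') f = permHom w (permHom w' f) :=
  lambdaHat_ext fun m => permRT_mul w w' (MvPowerSeries.coeff m f.1)

theorem permHom_one (f : LambdaHat n) : permHom (1 : Equiv.Perm (ZMod n)) f = f :=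
  lambdaHat_ext fun m => permRT_one (MvPowerSeries.coeff m f.1)

theorem permHom_algebraMap (w : Equiv.Perm (ZMod n)) (r : RT n) :
    permHom w (algebraMap (RT n) (LambdaHat n) r) = algebraMap (RT n) (LambdaHat n) (permRT w r) :=
  Subtype.ext (MvPowerSeries.map_C (permRT w) r)

/-- The element `e^{-a_j}` of `Λ̂`. -/
noncomputable def xElt (j : ZMod n) : LambdaHat n := algebraMap (RT n) (LambdaHat n) (ex (-wt j))

theorem permHom_xElt (w : Equiv.Perm (ZMod n)) (j : ZMod n) :
    permHom w (xElt j) = xElt (w j) := by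
  rw [xElt, permHom_algebraMap, permRT_ex, map_neg, permWeight_wt, xElt]

theorem permRT_bpar (w : Equiv.Perm (ZMod n)) (j : ZMod n) : permRT w (bpar j) = bpar (w j) := by
  rw [bpar, map_sub, map_one, permRT_ex, map_neg, permWeight_wt, bpar]

theorem permHom_Omega (w : Equiv.Perm (ZMod n)) (j : ZMod n) :
    permHom w (Omega (bpar j) : LambdaHat n) = (Omega (bpar (w j)) : LambdaHat n) :=
  lambdaHat_ext fun m => by
    change permRT w (bpar j ^ m.degree) = bpar (w j) ^ m.degree
    rw [map_pow, permRT_bpar]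

instance [NeZero n] : NoZeroDivisors (LambdaHat n) where
  eq_zero_or_eq_zero_of_mul_eq_zero {f g} h := by
    have h1 : f.1 * g.1 = 0 := congrArg Subtype.val h
    rcases mul_eq_zero.1 h1 with h2 | h2
    · exact Or.inl (Subtype.ext h2)
    · exact Or.inr (Subtype.ext h2)

theorem algebraMap_lambdaHat_injective : Function.Injective (algebraMap (RT n) (LambdaHat n)) := by
  intro r s h
  exact MvPowerSeries.C_injective (congrArg Subtype.val h)

theorem ex_injective : Function.Injective (ex : Weight n → RT n) := fun _ _ h =>
  AddMonoidAlgebra.single_left_injective one_ne_zero h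

theorem wt_injective (hn : 3 ≤ n) : Function.Injective (wt : ZMod n → Weight n) := by
  intro i j h
  by_contra hij
  rw [wt, wt, QuotientAddGroup.eq, AddSubgroup.mem_zmultiples_iff] at h
  obtain ⟨c, hc⟩ := h
  -- The coordinate at a third index gives `c = 0`, contradicting the one at `i`.
  obtain ⟨k, hki, hkj⟩ : ∃ k : ZMod n, k ≠ i ∧ k ≠ j := by
    have : NeZero n := ⟨by omega⟩
    have h1 : ({i, j} : Finset (ZMod n)).card < (Finset.univ : Finset (ZMod n)).card := by
      rw [Finset.card_univ, ZMod.card]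
      exact Finset.card_le_two.trans_lt (by omega)
    obtain ⟨k, -, hk⟩ := Finset.exists_mem_notMem_of_card_lt_card h1
    simp only [Finset.mem_insert, Finset.mem_singleton, not_or] at hk
    exact ⟨k, hk.1, hk.2⟩
  have e1 := congrFun hc k
  have e2 := congrFun hc i
  simp [hki, hkj, Ne.symm hij] at e1 e2
  omega

theorem xElt_ne_xElt_succ [NeZero n] (hn : 2 ≤ n) (j : ZMod n) : xElt j ≠ xElt (j + 1) := by
  intro h
  have h1 := ex_injective (algebraMap_lambdaHat_injective h)
  refine one_sub_ex_simpleRoot_ne_zero hn j ?_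
  rw [simpleRoot, neg_injective h1, sub_self, ex_zero, sub_self]

theorem xElt_injective (hn : 2 ≤ n) : Function.Injective (xElt : ZMod n → LambdaHat n) := by
  intro j k h
  rcases hn.lt_or_eq with h3 | rfl
  · exact wt_injective h3 (neg_injective (ex_injective (algebraMap_lambdaHat_injective h)))
  · have h1 : ∀ j k : ZMod 2, j = k ∨ k = j + 1 := by decide
    rcases h1 j k with h2 | rfl
    · exact h2
    · exact absurd h (xElt_ne_xElt_succ le_rfl j)

/-- `s_j` as an additive endomorphism of `Λ̂`. -/
noncomputable def reflHom (j : ZMod n) : LambdaHat n →+ LambdaHat n where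
  toFun := simpleRefl j
  map_zero' := by
    simp only [simpleRefl, ← permHom_apply, map_zero, mul_zero, ite_self]
  map_add' f g := by
    simp only [simpleRefl, ← permHom_apply, map_add, mul_add]
    split_ifs <;> rfl

theorem reflHom_apply (j : ZMod n) (f : LambdaHat n) : reflHom j f = simpleRefl j f := rfl

theorem reflHom_mul (j : ZMod n) (c f : LambdaHat n) :
    reflHom j (c * f) = permHom (Equiv.swap j (j + 1)) c * reflHom j f := by
  simp only [reflHom_apply, simpleRefl, ← permHom_apply, map_mul]
  split_ifs with h
  · subst h
    rw [zero_add]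
    ring
  · rfl

theorem reflHom_xElt_mul (j k : ZMod n) (f : LambdaHat n) :
    reflHom j (xElt k * f) = xElt (Equiv.swap j (j + 1) k) * reflHom j f := by
  rw [reflHom_mul, permHom_xElt]

/-- Multiplying the definition by `e^{-a_j}` and using `e^{-a_j} e^{α_j} = e^{-a_{j+1}}` gives the
form of the abstract Demazure identities. -/
theorem xElt_sub_mul_demazureT [NeZero n] (j : ZMod n) (f : LambdaHat n) :
    (xElt j - xElt (j + 1)) * demazureT j f = xElt j * (simpleRefl j f - f) := by
  have h := demazureT_spec j f
  rw [← h, Algebra.smul_def, ← mul_assoc]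
  congr 1
  rw [xElt, xElt, ← map_sub, ← map_mul, mul_sub, mul_one, ← ex_add]
  congr 3
  rw [simpleRoot]
  abel_nf

theorem xElt_sub_mul_demazureD [NeZero n] (j : ZMod n) (f : LambdaHat n) :
    (xElt j - xElt (j + 1)) * demazureD j f = xElt j * simpleRefl j f - xElt (j + 1) * f := by
  rw [demazureD, mul_add, xElt_sub_mul_demazureT]
  ring

/-- The product `Ω(b_0|y) Ω(b_{-1}|y) ⋯ Ω(b_{1-m}|y)`. -/
noncomputable def omegaProd (n m : ℕ) : (LambdaHat n)ˣ :=
  ∏ r ∈ Finset.range m, Omega (bpar (-(r : ZMod n)))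

theorem xi_kRect {i : ℕ} (hi : 1 ≤ i) : xi (kRect n i) = omegaProd n (n - i) := by
  rw [xi, omegaProd, colLen_kRect hi]
  simp [res]

theorem coe_omegaProd (m : ℕ) : (omegaProd n m : LambdaHat n) =
    ∏ r ∈ Finset.range m, (Omega (bpar (-(r : ZMod n))) : LambdaHat n) := by
  rw [omegaProd, Units.coe_prod]

theorem natCast_injOn_zmod {a b : ℕ} (ha : a < n) (hb : b < n) :
    (a : ZMod n) = b ↔ a = b := by
  rw [ZMod.natCast_eq_natCast_iff', Nat.mod_eq_of_lt ha, Nat.mod_eq_of_lt hb]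

/-- The exchange of `j` and `j + 1` preserves the set of indices `0, -1, …, 1 - m` unless it
contains exactly one of them, which can happen only for `j = -m` and `j = 0`. -/
theorem permHom_swap_prod_range {F : ZMod n → LambdaHat n}
    (hF : ∀ w j, permHom w (F j) = F (w j)) {j : ZMod n} [NeZero n] {m : ℕ} (hm : m < n)
    (hj : j ≠ -(m : ZMod n)) (hj0 : j ≠ 0) :
    permHom (Equiv.swap j (j + 1)) (∏ r ∈ Finset.range m, F (-(r : ZMod n))) =
      ∏ r ∈ Finset.range m, F (-(r : ZMod n)) := by
  obtain ⟨r, hr, rfl⟩ : ∃ r : ℕ, r < n ∧ j = -(r : ZMod n) :=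
    ⟨(-j).val, ZMod.val_lt _, by simp⟩
  have hrm : r ≠ m := fun h => hj (by rw [h])
  obtain ⟨t, rfl⟩ : ∃ t, r = t + 1 := Nat.exists_eq_succ_of_ne_zero (fun h => hj0 (by rw [h]; simp))
  have hs : ∀ a : ℕ, a < n → Equiv.swap (-((t + 1 : ℕ) : ZMod n)) (-((t + 1 : ℕ) : ZMod n) + 1)
      (-(a : ZMod n)) = -((Equiv.swap t (t + 1) a : ℕ) : ZMod n) := by
    intro a ha
    have e : -((t + 1 : ℕ) : ZMod n) + 1 = -(t : ZMod n) := by push_cast; ring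
    rw [e, Equiv.swap_apply_def, Equiv.swap_apply_def]
    simp only [neg_inj, natCast_injOn_zmod ha hr, natCast_injOn_zmod ha (show t < n by omega)]
    split_ifs <;> first | rfl | omega
  rw [map_prod]
  simp only [hF]
  by_cases hlt : m < t + 1
  · refine Finset.prod_congr rfl fun a ha => ?_
    rw [Finset.mem_range] at ha
    rw [hs a (by omega), Equiv.swap_apply_of_ne_of_ne (by omega) (by omega)]
  · refine Finset.prod_equiv (Equiv.swap t (t + 1)) (fun a => ?_) (fun a ha => ?_)
    · simp only [Finset.mem_range, Equiv.swap_apply_def]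
      split_ifs <;> omega
    · rw [Finset.mem_range] at ha
      rw [hs a (by omega)]

theorem permHom_omegaProd_of_ne {j : ZMod n} [NeZero n] {m : ℕ} (hm : m < n) (hj : j ≠ -(m : ZMod n))
    (hj0 : j ≠ 0) :
    permHom (Equiv.swap j (j + 1)) (omegaProd n m : LambdaHat n) = (omegaProd n m : LambdaHat n) := by
  rw [coe_omegaProd]
  exact permHom_swap_prod_range permHom_Omega hm hj hj0

/-- The exchange of `0` and `1` replaces the factor `Ω(b_0)` by `Ω(b_1)` and nothing else, since `1`
is not among the indices of the product; this is precisely the twist in `s_0`. -/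
theorem permHom_omegaProd_zero {m : ℕ} (hm : m + 1 < n) :
    permHom (Equiv.swap (0 : ZMod n) 1) (omegaProd n (m + 1) : LambdaHat n) *
      (Omega (bpar (0 : ZMod n)) : LambdaHat n) =
    (Omega (bpar (1 : ZMod n)) : LambdaHat n) * (omegaProd n (m + 1) : LambdaHat n) := by
  rw [coe_omegaProd, map_prod]
  simp only [permHom_Omega]
  rw [Finset.prod_range_succ', Finset.prod_range_succ']
  have h : ∀ a ∈ Finset.range m, (Omega (bpar (Equiv.swap (0 : ZMod n) 1 (-((a + 1 : ℕ) : ZMod n)))) :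
      LambdaHat n) = Omega (bpar (-((a + 1 : ℕ) : ZMod n))) := by
    intro a ha
    rw [Finset.mem_range] at ha
    rw [Equiv.swap_apply_of_ne_of_ne]
    · rw [ne_eq, neg_eq_zero, ← Nat.cast_zero, natCast_injOn_zmod (by omega) (by omega)]
      omega
    · have h2 : ((a + 1 : ℕ) : ZMod n) + 1 = ((a + 2 : ℕ) : ZMod n) := by push_cast; ring
      rw [ne_eq, neg_eq_iff_add_eq_zero, h2, ← Nat.cast_zero,
        natCast_injOn_zmod (by omega) (by omega)]
      omega
  rw [Finset.prod_congr rfl h]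
  simp only [Nat.cast_zero, neg_zero, Equiv.swap_apply_left]
  ring

/-- Away from the node `-m`, the product `Ω(b_0|y) ⋯ Ω(b_{1-m}|y)` turns the operators `s_j` into
permutations of the indices. -/
theorem omegaProd_mul_simpleRefl [NeZero n] {m : ℕ} (hm : m < n) {j : ZMod n}
    (hj : j ≠ -(m : ZMod n)) (f : LambdaHat n) :
    (omegaProd n m : LambdaHat n) * simpleRefl j f =
      permHom (Equiv.swap j (j + 1)) ((omegaProd n m : LambdaHat n) * f) := by
  rw [map_mul, simpleRefl]
  split_ifs with h0
  · subst h0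
    obtain ⟨t, rfl⟩ : ∃ t, m = t + 1 := Nat.exists_eq_succ_of_ne_zero (fun h => hj (by simp [h]))
    have h1 := permHom_omegaProd_zero hm
    have h2 : ((Omega (bpar (0 : ZMod n)) : (LambdaHat n)ˣ) : LambdaHat n) *
        (((Omega (bpar (0 : ZMod n)))⁻¹ : (LambdaHat n)ˣ) : LambdaHat n) = 1 := Units.mul_inv _
    rw [zero_add, Units.val_mul, permHom_apply _ f]
    linear_combination (-(((Omega (bpar (0 : ZMod n)))⁻¹ : (LambdaHat n)ˣ) : LambdaHat n) *
      permLambda (Equiv.swap 0 1) f) * h1 + permHom (Equiv.swap (0 : ZMod n) 1)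
        (omegaProd n (t + 1) : LambdaHat n) * permLambda (Equiv.swap 0 1) f * h2
  · rw [permHom_omegaProd_of_ne hm hj h0, permHom_apply _ f]

theorem exists_neg_natCast [NeZero n] (j : ZMod n) : ∃ m < n, j = -(m : ZMod n) :=
  ⟨(-j).val, ZMod.val_lt _, by simp⟩

/-- Choosing `-m = j + 1` and multiplying by the unit `omegaProd n m` makes `s_j` a transposition.
-/
theorem reflHom_reflHom [NeZero n] (hn : 2 ≤ n) (j : ZMod n) (f : LambdaHat n) :
    reflHom j (reflHom j f) = f := by
  have h1 := one_ne_zero_zmod hn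
  obtain ⟨m, hm, hjm⟩ := exists_neg_natCast (j + 1)
  have hj : j ≠ -(m : ZMod n) := by
    rw [← hjm]
    simpa using h1
  refine (Units.mul_right_inj (omegaProd n m)).1 ?_
  rw [reflHom_apply, omegaProd_mul_simpleRefl hm hj, reflHom_apply, omegaProd_mul_simpleRefl hm hj,
    ← permHom_mul, Equiv.swap_mul_self, permHom_one]

/-- A relation between two nodes leaves a third node `-m` free, so after multiplication by
`omegaProd n m` it becomes a relation between transpositions. -/
theorem exists_ne_ne (hn : 3 ≤ n) (j k : ZMod n) : ∃ m < n, j ≠ -(m : ZMod n) ∧ k ≠ -(m : ZMod n) := by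
  have : NeZero n := ⟨by omega⟩
  have h1 : ({j, k} : Finset (ZMod n)).card < (Finset.univ : Finset (ZMod n)).card := by
    rw [Finset.card_univ, ZMod.card]
    exact Finset.card_le_two.trans_lt (by omega)
  obtain ⟨e, -, he⟩ := Finset.exists_mem_notMem_of_card_lt_card h1
  simp only [Finset.mem_insert, Finset.mem_singleton, not_or] at he
  obtain ⟨m, hm, rfl⟩ := exists_neg_natCast e
  exact ⟨m, hm, Ne.symm he.1, Ne.symm he.2⟩

theorem reflHom_comm [NeZero n] (hn : 3 ≤ n) {j k : ZMod n} (h1 : j ≠ k) (h2 : k ≠ j + 1)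
    (h3 : j ≠ k + 1) (f : LambdaHat n) :
    reflHom j (reflHom k f) = reflHom k (reflHom j f) := by
  obtain ⟨m, hm, hj, hk⟩ := exists_ne_ne hn j k
  refine (Units.mul_right_inj (omegaProd n m)).1 ?_
  simp only [reflHom_apply, omegaProd_mul_simpleRefl hm hj, omegaProd_mul_simpleRefl hm hk,
    ← permHom_mul]
  congr 2
  refine (Equiv.Perm.disjoint_iff_disjoint_support.2 ?_).commute
  rw [Equiv.Perm.support_swap, Equiv.Perm.support_swap]
  · simp only [Finset.disjoint_insert_left, Finset.mem_insert, Finset.mem_singleton, not_or,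
      Finset.disjoint_singleton_left]
    refine ⟨⟨h1, h3⟩, h2.symm, ?_⟩
    simpa using h1
  · have := one_ne_zero_zmod (n := n) (by omega)
    simpa using this
  · have := one_ne_zero_zmod (n := n) (by omega)
    simpa using this

theorem add_one_add_one_ne (hn : 3 ≤ n) (j : ZMod n) : j + 1 + 1 ≠ j := by
  rw [add_assoc, ne_eq, add_eq_left, one_add_one_eq_two]
  exact two_ne_zero_zmod hn

theorem add_one_ne (hn : 2 ≤ n) (j : ZMod n) : j + 1 ≠ j := by
  rw [ne_eq, add_eq_left]
  exact one_ne_zero_zmod hn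

theorem reflHom_braid [NeZero n] (hn : 3 ≤ n) (j : ZMod n) (f : LambdaHat n) :
    reflHom j (reflHom (j + 1) (reflHom j f)) =
      reflHom (j + 1) (reflHom j (reflHom (j + 1) f)) := by
  have h1 := add_one_ne (n := n) (by omega) j
  have h2 := add_one_ne (n := n) (by omega) (j + 1)
  have h3 := add_one_add_one_ne hn j
  obtain ⟨m, hm, hj, hk⟩ := exists_ne_ne hn j (j + 1)
  refine (Units.mul_right_inj (omegaProd n m)).1 ?_
  simp only [reflHom_apply, omegaProd_mul_simpleRefl hm hj, omegaProd_mul_simpleRefl hm hk,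
    ← permHom_mul]
  congr 2
  have h4 := Equiv.swap_mul_swap_mul_swap h2 h3
  rw [Equiv.swap_comm (j + 1) j, Equiv.swap_comm (j + 1 + 1) (j + 1),
    Equiv.swap_comm j (j + 1 + 1)] at h4
  rw [← mul_assoc, ← mul_assoc, Equiv.swap_mul_swap_mul_swap h1.symm h3.symm, h4]

/-- The Demazure operator `D_j` as an additive endomorphism of `Λ̂`. -/
noncomputable def demazureEnd [NeZero n] (hn : 2 ≤ n) (j : ZMod n) :
    AddMonoid.End (LambdaHat n) :=
  AddMonoidHom.mk' (demazureD j) fun f g => by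
    refine mul_left_cancel₀ (sub_ne_zero.2 (xElt_ne_xElt_succ hn j)) ?_
    rw [mul_add]
    simp only [xElt_sub_mul_demazureD, ← reflHom_apply, map_add]
    ring

/-- The Demazure operator `T_j` as an additive endomorphism of `Λ̂`. -/
noncomputable def demazureTEnd [NeZero n] (hn : 2 ≤ n) (j : ZMod n) :
    AddMonoid.End (LambdaHat n) :=
  AddMonoidHom.mk' (demazureT j) fun f g => by
    refine mul_left_cancel₀ (sub_ne_zero.2 (xElt_ne_xElt_succ hn j)) ?_
    rw [mul_add]
    simp only [xElt_sub_mul_demazureT, ← reflHom_apply, map_add]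
    ring

theorem demazureEnd_mul_self [NeZero n] (hn : 2 ≤ n) (j : ZMod n) :
    demazureEnd hn j * demazureEnd hn j = demazureEnd hn j := by
  have hne := xElt_ne_xElt_succ hn j
  ext1 f
  have sx : ∀ f, reflHom j (xElt j * f) = xElt (j + 1) * reflHom j f := fun f => by
    rw [reflHom_xElt_mul, Equiv.swap_apply_left]
  have sy : ∀ f, reflHom j (xElt (j + 1) * f) = xElt j * reflHom j f := fun f => by
    rw [reflHom_xElt_mul, Equiv.swap_apply_right]
  exact demazure_eq_self hne (reflHom j) (xElt_sub_mul_demazureD j)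
    (demazure_fixed hne (reflHom j) sx sy (reflHom_reflHom hn j) (xElt_sub_mul_demazureD j) f)

theorem demazureEnd_comm [NeZero n] (hn : 3 ≤ n) {j k : ZMod n} (h1 : j ≠ k) (h2 : k ≠ j + 1)
    (h3 : j ≠ k + 1) : demazureEnd (by omega) j * demazureEnd (by omega) k =
      demazureEnd (by omega) k * demazureEnd (by omega) j := by
  have hn2 : 2 ≤ n := by omega
  have h4 : j + 1 ≠ k + 1 := by simpa using h1
  ext1 f
  refine demazure_comm (xElt_ne_xElt_succ hn2 j) (xElt_ne_xElt_succ hn2 k) (reflHom j) (reflHom k)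
    ?_ ?_ ?_ ?_ (reflHom_comm hn h1 h2 h3) (xElt_sub_mul_demazureD j) (xElt_sub_mul_demazureD k) f
  all_goals
    intro f
    rw [reflHom_xElt_mul, Equiv.swap_apply_of_ne_of_ne]
  exacts [h1.symm, h2, h3.symm, h4.symm, h1, h3, h2.symm, h4]

theorem demazureEnd_braid [NeZero n] (hn : 3 ≤ n) (j : ZMod n) :
    demazureEnd (by omega) j * demazureEnd (by omega) (j + 1) * demazureEnd (by omega) j =
      demazureEnd (by omega) (j + 1) * demazureEnd (by omega) j *
        demazureEnd (by omega) (j + 1) := by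
  have hn2 : 2 ≤ n := by omega
  have h1 := add_one_ne hn2 j
  have h2 := add_one_ne hn2 (j + 1)
  have h3 := add_one_add_one_ne hn j
  ext1 f
  refine demazure_braid (xElt_ne_xElt_succ hn2 j) (xElt_ne_xElt_succ hn2 (j + 1))
    (fun h => h3 (xElt_injective hn2 h).symm) (reflHom j) (reflHom (j + 1))
    ?_ ?_ ?_ (reflHom_reflHom hn2 j) ?_ ?_ ?_ (reflHom_reflHom hn2 (j + 1)) (reflHom_braid hn j)
    (xElt_sub_mul_demazureD j) (xElt_sub_mul_demazureD (j + 1)) f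
  all_goals
    intro f
    rw [reflHom_xElt_mul]
  · rw [Equiv.swap_apply_left]
  · rw [Equiv.swap_apply_right]
  · rw [Equiv.swap_apply_of_ne_of_ne h3 h2]
  · rw [Equiv.swap_apply_of_ne_of_ne h1.symm h3.symm]
  · rw [Equiv.swap_apply_left]
  · rw [Equiv.swap_apply_right]

/-! ### Independence of the reduced word. -/

theorem foldr_demazureD [NeZero n] (hn : 2 ≤ n) (ω : List (ZMod n)) (f : LambdaHat n) :
    ω.foldr demazureD f = (ω.map (demazureEnd hn)).prod f := by
  induction ω with
  | nil => rfl
  | cons j ω ih => rw [List.foldr_cons, ih, List.map_cons, List.prod_cons]; rfl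

theorem foldr_demazureT [NeZero n] (hn : 2 ≤ n) (ω : List (ZMod n)) (f : LambdaHat n) :
    ω.foldr demazureT f = (ω.map (demazureTEnd hn)).prod f := by
  induction ω with
  | nil => rfl
  | cons j ω ih => rw [List.foldr_cons, ih, List.map_cons, List.prod_cons]; rfl

/-- Transfers the braid relation from `D = T + 1` to `T`: by idempotency the lower terms of the two
expansions coincide. -/
theorem braid_of_add_one {R : Type*} [Ring R] {s t : R} (hs : (s + 1) * (s + 1) = s + 1)
    (ht : (t + 1) * (t + 1) = t + 1)
    (h : (s + 1) * (t + 1) * (s + 1) = (t + 1) * (s + 1) * (t + 1)) :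
    s * t * s = t * s * t := by
  have e1 : (s + 1) * (t + 1) * (s + 1) =
      s * t * s + s * t + t * s + (s + 1) * (s + 1) + t := by noncomm_ring
  have e2 : (t + 1) * (s + 1) * (t + 1) =
      t * s * t + s * t + t * s + (t + 1) * (t + 1) + s := by noncomm_ring
  rw [e1, e2, hs, ht] at h
  have e3 : s * t * s + s * t + t * s + (s + 1) + t = s * t * s + (s * t + t * s + (s + 1) + t) := by
    abel
  have e4 : t * s * t + s * t + t * s + (t + 1) + s = t * s * t + (s * t + t * s + (s + 1) + t) := by
    abel
  rw [e3, e4] at h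
  exact add_right_cancel h

theorem comm_of_add_one {R : Type*} [Ring R] {s t : R}
    (h : (s + 1) * (t + 1) = (t + 1) * (s + 1)) : s * t = t * s := by
  have e1 : (s + 1) * (t + 1) = s * t + (s + t + 1) := by noncomm_ring
  have e2 : (t + 1) * (s + 1) = t * s + (s + t + 1) := by noncomm_ring
  rw [e1, e2] at h
  exact add_right_cancel h

theorem foldr_eq_of_isReduced [NeZero n] (hn : 3 ≤ n) {ω ω' : List (ZMod n)}
    (hω : (affineSystem n).IsReduced ω) (hω' : (affineSystem n).IsReduced ω')
    (h : (affineSystem n).wordProd ω = (affineSystem n).wordProd ω') (f : LambdaHat n) :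
    ω.foldr demazureD f = ω'.foldr demazureD f ∧ ω.foldr demazureT f = ω'.foldr demazureT f := by
  have hn2 : 2 ≤ n := by omega
  constructor
  · rw [foldr_demazureD hn2, foldr_demazureD hn2, prod_map_eq_of_isReduced hn (demazureEnd hn2)
      (fun j k h1 h2 h3 => demazureEnd_comm hn h1 h2 h3) (demazureEnd_braid hn) hω hω' h]
  · rw [foldr_demazureT hn2, foldr_demazureT hn2, prod_map_eq_of_isReduced hn (demazureTEnd hn2)
      (fun j k h1 h2 h3 => comm_of_add_one (demazureEnd_comm hn h1 h2 h3))
      (fun j => braid_of_add_one (demazureEnd_mul_self hn2 j) (demazureEnd_mul_self hn2 (j + 1))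
        (demazureEnd_braid hn j)) hω hω' h]

theorem isReduced_reducedWord (x : AffineWeyl n) : (affineSystem n).IsReduced (reducedWord x) :=
  ((affineSystem n).exists_isReduced x).choose_spec.1

theorem wordProd_reducedWord (x : AffineWeyl n) : (affineSystem n).wordProd (reducedWord x) = x :=
  ((affineSystem n).exists_isReduced x).choose_spec.2.symm

/-- This covers `n = 2`, where every word needed later has at most one letter. -/
theorem eq_of_length_le_one (hn : 2 ≤ n) {ω ω' : List (ZMod n)}
    (hω : (affineSystem n).IsReduced ω) (hω' : (affineSystem n).IsReduced ω')
    (h : (affineSystem n).wordProd ω = (affineSystem n).wordProd ω') (hl : ω.length ≤ 1) :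
    ω = ω' := by
  have hlen : ω.length = ω'.length := by rw [← hω.eq, ← hω'.eq, h]
  rcases ω with _ | ⟨j, _ | ⟨k, ω⟩⟩
  · exact (List.length_eq_zero_iff.1 hlen.symm).symm
  · obtain ⟨k, rfl⟩ := List.length_eq_one_iff.1 hlen.symm
    rw [CoxeterSystem.wordProd_singleton, CoxeterSystem.wordProd_singleton] at h
    rw [simple_injective hn h]
  · simp at hl

/-- The operators `D_x` and `T_x` can be computed along any reduced word `ω`; for `n = 2` this is
only recorded for words of length at most `1`. -/
theorem opD_opT_wordProd [NeZero n] (hn : 2 ≤ n) {ω : List (ZMod n)}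
    (hω : (affineSystem n).IsReduced ω) (hl : 3 ≤ n ∨ ω.length ≤ 1) (f : LambdaHat n) :
    opD ((affineSystem n).wordProd ω) f = ω.foldr demazureD f ∧
      opT ((affineSystem n).wordProd ω) f = ω.foldr demazureT f := by
  have h1 := isReduced_reducedWord ((affineSystem n).wordProd ω)
  have h2 := wordProd_reducedWord ((affineSystem n).wordProd ω)
  rcases hl with hn3 | hl
  · exact foldr_eq_of_isReduced hn3 h1 hω h2 f
  · rw [opD, opT, ← eq_of_length_le_one hn hω h1 h2.symm hl]
    exact ⟨rfl, rfl⟩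

theorem kSchurPart_kRect [NeZero n] (hn : 2 ≤ n) {i : ℕ} (hi : 1 ≤ i) (hin : i ≤ n) :
    kSchurClosedPart (kRect n i) = (rectWord n i (n - i)).foldr demazureD 1 ∧
      kSchurPart (kRect n i) = (rectWord n i (n - i)).foldr demazureT 1 := by
  have h := opD_opT_wordProd hn (isReduced_rectWord hn hi (Nat.add_sub_cancel' hin)) (by
    rw [length_rectWord]
    by_contra! h
    obtain rfl : n = 2 := by omega
    interval_cases i <;> omega) 1
  rw [← residueWord_kRect hi] at h ⊢
  exact h

theorem rectWord_suffix (i m k : ℕ) : ∃ ω, rectWord n i (m + k) = ω ++ rectWord n i m := by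
  induction k with
  | zero => exact ⟨[], rfl⟩
  | succ k ih =>
    obtain ⟨ω, hω⟩ := ih
    exact ⟨_ ++ ω, by rw [← add_assoc, rectWord_succ, hω, List.append_assoc]⟩

/-- The word of `ρ_l`. -/
def rhoWord (n l : ℕ) : List (ZMod n) := (List.range l).reverse.map Nat.cast

theorem rho_eq (l : ℕ) : rho n l = (affineSystem n).wordProd (rhoWord n l) := by
  rw [rho, rhoWord]
  congr 1
  simp [← List.map_eq_flatMap]

theorem rectWord_one (l : ℕ) : rectWord n l 1 = rhoWord n l := by
  simp [rectWord, rhoWord, res]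

/-- For `l > 0` the word of `ρ_l` is the top row of the rectangle with `n - l` rows of length `l`,
which is read last; it is a suffix of a reduced word. -/
theorem kSchur_rho [NeZero n] (hn : 2 ≤ n) {l : ℕ} (hl : l < n) :
    kSchur (rho n l) = (rhoWord n l).foldr demazureT 1 := by
  rw [rho_eq]
  refine (opD_opT_wordProd hn ?_ ?_ 1).2
  · rcases Nat.eq_zero_or_pos l with rfl | hl0
    · simp [CoxeterSystem.IsReduced, rhoWord]
    · have h1 := isReduced_rectWord hn hl0 (Nat.add_sub_cancel' hl.le)
      obtain ⟨ω, hω⟩ := rectWord_suffix (n := n) l 1 (n - l - 1)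
      rw [show 1 + (n - l - 1) = n - l by omega, rectWord_one] at hω
      rw [hω] at h1
      simpa using h1.drop ω.length
  · rw [rhoWord, List.length_map, List.length_reverse, List.length_range]
    omega

end KkSchur

/-! ### Rectangles in the 0-Hecke monoid. -/

section ZeroHecke

/-- The composite `d (a + k - 1) ∘ ⋯ ∘ d (a + 1) ∘ d a`. -/
def heckeChain {B : Type*} (d : ℕ → B → B) (a : ℕ) : ℕ → B → B
  | 0, f => f
  | k + 1, f => d (a + k) (heckeChain d a k f)

/-- The composite of `t` chains of length `k`, starting at `m`, `m - 1`, …. -/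
def heckeRect {B : Type*} (d : ℕ → B → B) (m k : ℕ) : ℕ → B → B
  | 0, f => f
  | t + 1, f => heckeChain d (m - t) k (heckeRect d m k t f)

/-- Idempotent operators `d 1, …, d (n - 1)` satisfying the braid relations of type `A_{n-1}`. -/
structure IsZeroHecke {B : Type*} (n : ℕ) (d : ℕ → B → B) : Prop where
  idem : ∀ p f, 1 ≤ p → p < n → d p (d p f) = d p f
  comm : ∀ p q f, 1 ≤ p → p + 1 < q → q < n → d p (d q f) = d q (d p f)
  braid : ∀ p f, 1 ≤ p → p + 1 < n → d p (d (p + 1) (d p f)) = d (p + 1) (d p (d (p + 1) f))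

namespace IsZeroHecke

variable {B : Type*} {n : ℕ} {d : ℕ → B → B} (h : IsZeroHecke n d)
include h

theorem chain_comm_of_lt {a k q : ℕ} (ha : 1 ≤ a) (hq : a + k < q) (hqn : q < n) (f : B) :
    d q (heckeChain d a k f) = heckeChain d a k (d q f) := by
  induction k with
  | zero => rfl
  | succ k ih =>
    rw [heckeChain, heckeChain, ← h.comm _ _ _ (by omega) (by omega) hqn, ih (by omega)]

theorem chain_comm_of_gt {a k q : ℕ} (hq : 1 ≤ q) (hqa : q + 1 < a) (hn : a + k ≤ n) (f : B) :
    d q (heckeChain d a k f) = heckeChain d a k (d q f) := by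
  induction k with
  | zero => rfl
  | succ k ih =>
    rw [heckeChain, heckeChain, h.comm _ _ _ hq (by omega) (by omega), ih (by omega)]

/-- At the letters `p + 1, p` of the chain the braid relation turns `d p` into `d (p + 1)`, which
commutes with all smaller letters. -/
theorem chain_shift {a k p : ℕ} (ha : 1 ≤ a) (hp : a ≤ p) (hpk : p + 1 < a + k) (hn : a + k ≤ n)
    (f : B) : d p (heckeChain d a k f) = heckeChain d a k (d (p + 1) f) := by
  induction k with
  | zero => omega
  | succ k ih =>
    by_cases hpe : p + 1 = a + k
    · obtain ⟨l, rfl⟩ : ∃ l, k = l + 1 := ⟨k - 1, by omega⟩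
      obtain rfl : p = a + l := by omega
      simp only [heckeChain]
      rw [← add_assoc, h.braid _ _ (by omega) (by omega),
        h.chain_comm_of_lt ha (by omega) (by omega)]
    · rw [heckeChain, heckeChain, h.comm _ _ _ (by omega) (by omega) (by omega), ih (by omega)
        (by omega)]

/-- The braid relation at the top letters of the two chains reproduces the situation with `k`
lowered by one. -/
theorem chain_chain {a k : ℕ} (ha : 1 ≤ a) (hn : a + k < n) (f : B) :
    d (a + k) (heckeChain d a k (heckeChain d (a + 1) k f)) =
      heckeChain d a k (heckeChain d (a + 1) k (d a f)) := by
  induction k with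
  | zero => rfl
  | succ k ih =>
    simp only [heckeChain]
    rw [show a + 1 + k = a + k + 1 by omega, ← h.chain_comm_of_lt ha (by omega) (by omega),
      ← h.chain_comm_of_lt ha (by omega) (by omega), ← add_assoc,
      ← h.braid _ _ (by omega) (by omega), ih (by omega)]

/-- The generator `d p` is moved through the outermost chain, or the outermost two if `p = a + k`,
and is absorbed by the smaller rectangle; for `p = a + k - 1` idempotency absorbs it at once. At `t
= m` the excluded value is `0`, so all generators fix the result. -/
theorem rect_fixed {m k t : ℕ} (hmk : m + k = n) (hk : 1 ≤ k) (ht : t ≤ m) {f : B}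
    (hf : ∀ p, 1 ≤ p → p < n → p ≠ m → d p f = f) {p : ℕ} (hp : 1 ≤ p) (hpn : p < n)
    (hpt : p ≠ m - t) : d p (heckeRect d m k t f) = heckeRect d m k t f := by
  induction t using Nat.strong_induction_on generalizing p with
  | _ t ih =>
    rcases t with _ | t
    · exact hf p hp hpn hpt
    obtain ⟨a, ha⟩ : ∃ a, m - t = a := ⟨_, rfl⟩
    have ih' : ∀ {p}, 1 ≤ p → p < n → p ≠ a → d p (heckeRect d m k t f) = heckeRect d m k t f := by
      intro p h1 h2 h3
      exact ih t (by omega) (by omega) h1 h2 (by omega)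
    rw [heckeRect, ha]
    rcases lt_or_ge p a with h1 | h1
    · rw [h.chain_comm_of_gt hp (by omega) (by omega), ih' hp hpn (by omega)]
    rcases lt_or_ge (p + 1) (a + k) with h2 | h2
    · rw [h.chain_shift (by omega) h1 h2 (by omega), ih' (by omega) (by omega) (by omega)]
    rcases Nat.lt_or_ge (a + k) p with h3 | h3
    · rw [h.chain_comm_of_lt (by omega) h3 hpn, ih' hp hpn (by omega)]
    by_cases h4 : p = a + k
    · subst h4
      obtain ⟨u, rfl⟩ : ∃ u, t = u + 1 := ⟨t - 1, by omega⟩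
      rw [heckeRect, show m - u = a + 1 by omega, h.chain_chain (by omega) hpn,
        ih u (by omega) (by omega) (by omega) (by omega) (by omega)]
    · obtain ⟨l, rfl⟩ : ∃ l, k = l + 1 := ⟨k - 1, by omega⟩
      obtain rfl : p = a + l := by omega
      rw [heckeChain, h.idem _ _ hp hpn]

end IsZeroHecke

end ZeroHecke

/-! ### The rectangle operator in finite type, and the passage from `T` to `D`. -/

namespace KkSchur

open Finset

variable {n : ℕ}

/-- The Demazure operators at the nodes `i + 1, i + 2, …`. -/
noncomputable def shiftedD [NeZero n] (i p : ℕ) : LambdaHat n → LambdaHat n :=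
  demazureD ((i + p : ℕ) : ZMod n)

theorem natCast_add_eq_iff {i p q : ℕ} (hp : p < n) (hq : q < n) :
    ((i + p : ℕ) : ZMod n) = ((i + q : ℕ) : ZMod n) ↔ p = q := by
  rw [Nat.cast_add, Nat.cast_add, add_right_inj, natCast_injOn_zmod hp hq]

theorem isZeroHecke_shiftedD [NeZero n] (hn : 2 ≤ n) (i : ℕ) :
    IsZeroHecke n (shiftedD (n := n) i) where
  idem p f _ _ := DFunLike.congr_fun (demazureEnd_mul_self hn ((i + p : ℕ) : ZMod n)) f
  comm p q f h1 h2 h3 := by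
    have hn3 : 3 ≤ n := by omega
    refine DFunLike.congr_fun (demazureEnd_comm hn3 (j := ((i + p : ℕ) : ZMod n))
      (k := ((i + q : ℕ) : ZMod n)) ?_ ?_ ?_) f
    · rw [ne_eq, natCast_add_eq_iff (by omega) h3]
      omega
    · rw [← Nat.cast_add_one, add_assoc, ne_eq, natCast_add_eq_iff h3 (by omega)]
      omega
    · rw [← Nat.cast_add_one, add_assoc, ne_eq]
      -- For `q = n - 1` the index `q + 1` wraps around to position `0`, which is not a position of
      -- a node.
      rcases (Nat.succ_le_of_lt h3).lt_or_eq with h4 | h4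
      · rw [natCast_add_eq_iff (by omega) h4]
        omega
      · have h5 : ((i + (q + 1) : ℕ) : ZMod n) = ((i + 0 : ℕ) : ZMod n) := by
          rw [← Nat.succ_eq_add_one, h4]
          simp
        rw [h5, natCast_add_eq_iff (by omega) (by omega)]
        omega
  braid p f h1 h2 := by
    have h3 := DFunLike.congr_fun (demazureEnd_braid (show 3 ≤ n by omega) ((i + p : ℕ) : ZMod n)) f
    rw [← Nat.cast_add_one, add_assoc] at h3
    exact h3

/-- Since `i + m = n`, the residue `c - r` is the node `i + (m - r + c)`, so counted from `i` a row
is a chain starting at `m - r`. -/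
theorem foldr_row {f : LambdaHat n} (d : ZMod n → LambdaHat n → LambdaHat n) {i m r : ℕ}
    (him : i + m = n) (hr : r ≤ m) (c : ℕ) :
    ((List.range c).reverse.map fun c => res n r c).foldr d f =
      heckeChain (fun p => d ((i + p : ℕ) : ZMod n)) (m - r) c f := by
  induction c with
  | zero => rfl
  | succ c ih =>
    rw [List.range_succ, List.reverse_append, List.reverse_singleton, List.singleton_append,
      List.map_cons, List.foldr_cons, ih, heckeChain]
    congr 1
    have h1 : i + (m - r + c) + r = c + n := by omega
    have h2 : ((i + (m - r + c) : ℕ) : ZMod n) + (r : ZMod n) = c := by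
      rw [← Nat.cast_add, h1]
      simp
    rw [res, ← h2, add_sub_cancel_right]

theorem foldr_rectWord {f : LambdaHat n} (d : ZMod n → LambdaHat n → LambdaHat n) {i m t : ℕ}
    (him : i + m = n) (ht : t ≤ m) :
    (rectWord n i t).foldr d f = heckeRect (fun p => d ((i + p : ℕ) : ZMod n)) m i t f := by
  induction t with
  | zero => rfl
  | succ t ih =>
    rw [rectWord_succ, List.foldr_append, ih (by omega), foldr_row d him (by omega), heckeRect]

theorem heckeChain_mul {B : Type*} [Mul B] {d : ℕ → B → B} {c : B} {a k : ℕ}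
    (hc : ∀ p, a ≤ p → p < a + k → ∀ f, d p (c * f) = c * d p f) (f : B) :
    heckeChain d a k (c * f) = c * heckeChain d a k f := by
  induction k with
  | zero => rfl
  | succ k ih =>
    rw [heckeChain, heckeChain, ih fun p h1 h2 => hc p h1 (by omega), hc _ (by omega) (by omega)]

theorem heckeRect_mul {B : Type*} [Mul B] {d : ℕ → B → B} {c : B} {m k t : ℕ} (ht : t ≤ m)
    (hc : ∀ p, m - t < p → p < m + k → ∀ f, d p (c * f) = c * d p f) (f : B) :
    heckeRect d m k t (c * f) = c * heckeRect d m k t f := by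
  induction t with
  | zero => rfl
  | succ t ih =>
    rw [heckeRect, heckeRect, ih (by omega) fun p h1 h2 => hc p (by omega) h2,
      heckeChain_mul fun p h1 h2 => hc p (by omega) (by omega)]

/-- The relation `x_{p+1} e_p = d_p x_p` telescopes: `x_a` enters the chain and `x_{a+k}` leaves it.
-/
theorem heckeChain_conj {B : Type*} [CommRing B] {d e : ℕ → B → B} {x : ℕ → B} {a k : ℕ}
    (h : ∀ p, a ≤ p → p < a + k → ∀ f, x (p + 1) * e p f = d p (x p * f)) (f : B) :
    x (a + k) * heckeChain e a k f = heckeChain d a k (x a * f) := by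
  induction k with
  | zero => rfl
  | succ k ih =>
    rw [heckeChain, heckeChain, ← ih fun p h1 h2 => h p h1 (by omega), ← h _ (by omega) (by omega)]
    rfl

/-- The factors of different rows do not interfere: those that have left have indices above all
later chains, and those still to enter have indices below all earlier ones. -/
theorem heckeRect_conj {B : Type*} [CommRing B] {d e : ℕ → B → B} {x : ℕ → B} {m k t : ℕ}
    (ht : t ≤ m) (h : ∀ p, 1 ≤ p → p < m + k → ∀ f, x (p + 1) * e p f = d p (x p * f))
    (hx : ∀ p q, 1 ≤ p → p < m + k → 1 ≤ q → q ≤ m + k → q ≠ p → q ≠ p + 1 →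
      ∀ f, d p (x q * f) = x q * d p f) (f : B) :
    (∏ s ∈ range t, x (m + k - s)) * heckeRect e m k t f =
      heckeRect d m k t ((∏ s ∈ range t, x (m - s)) * f) := by
  induction t with
  | zero => simp [heckeRect]
  | succ t ih =>
    have h1 : ∀ p, m - t ≤ p → p < m - t + k → ∀ f,
        d p ((∏ s ∈ range t, x (m + k - s)) * f) = (∏ s ∈ range t, x (m + k - s)) * d p f := by
      intro p hp1 hp2
      have : ∀ s, s ≤ t → ∀ f, d p ((∏ s ∈ range s, x (m + k - s)) * f) =
          (∏ s ∈ range s, x (m + k - s)) * d p f := by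
        intro s
        induction s with
        | zero => simp
        | succ s ihs =>
          intro hs f
          rw [prod_range_succ, mul_assoc, ihs (by omega), hx _ _ (by omega) (by omega) (by omega)
            (by omega) (by omega) (by omega), mul_assoc]
      exact this t le_rfl
    have h2 := heckeChain_conj (a := m - t) (k := k) (d := d) (e := e) (x := x)
      (fun p hp1 hp2 => h p (by omega) (by omega)) (heckeRect e m k t f)
    rw [prod_range_succ, prod_range_succ, heckeRect, heckeRect, mul_assoc,
      show m + k - t = m - t + k by omega, h2, ← heckeChain_mul h1, mul_left_comm, ih (by omega),
      mul_comm (∏ s ∈ range t, x (m - s)) (x (m - t)), mul_assoc,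
      heckeRect_mul (c := x (m - t)) (by omega)]
    intro p hp1 hp2
    exact hx _ _ (by omega) (by omega) (by omega) (by omega) (by omega) (by omega)

/-- Multiplied by `x_j - x_{j+1}`, both sides are `x_j x_{j+1} (s_j f - f)`. -/
theorem xElt_mul_demazureT [NeZero n] (hn : 2 ≤ n) (j : ZMod n) (f : LambdaHat n) :
    xElt (j + 1) * demazureT j f = demazureD j (xElt j * f) := by
  refine mul_left_cancel₀ (sub_ne_zero.2 (xElt_ne_xElt_succ hn j)) ?_
  rw [mul_left_comm, xElt_sub_mul_demazureT, xElt_sub_mul_demazureD, ← reflHom_apply j (xElt j * f),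
    reflHom_xElt_mul, Equiv.swap_apply_left, reflHom_apply]
  ring

theorem demazureD_xElt_mul [NeZero n] (hn : 2 ≤ n) {j k : ZMod n} (h1 : k ≠ j) (h2 : k ≠ j + 1)
    (f : LambdaHat n) : demazureD j (xElt k * f) = xElt k * demazureD j f := by
  refine mul_left_cancel₀ (sub_ne_zero.2 (xElt_ne_xElt_succ hn j)) ?_
  rw [mul_left_comm, xElt_sub_mul_demazureD, xElt_sub_mul_demazureD, ← reflHom_apply j (xElt k * f),
    reflHom_xElt_mul, Equiv.swap_apply_of_ne_of_ne h1 h2, reflHom_apply]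
  ring

theorem prod_xElt_mul_foldr_demazureT [NeZero n] (hn : 2 ≤ n) {i m : ℕ} (him : i + m = n)
    (f : LambdaHat n) :
    (∏ s ∈ range m, xElt ((i : ZMod n) - (s : ZMod n))) * (rectWord n i m).foldr demazureT f =
      (rectWord n i m).foldr demazureD ((∏ s ∈ range m, xElt (-(s : ZMod n))) * f) := by
  rw [foldr_rectWord demazureT him le_rfl, foldr_rectWord demazureD him le_rfl]
  have key := heckeRect_conj (B := LambdaHat n) (d := fun p => demazureD ((i + p : ℕ) : ZMod n))
    (e := fun p => demazureT ((i + p : ℕ) : ZMod n)) (x := fun p => xElt ((i + p : ℕ) : ZMod n))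
    (m := m) (k := i) le_rfl ?_ ?_ f
  · have e1 : ∀ s ∈ range m, xElt ((i + (m + i - s) : ℕ) : ZMod n) =
        xElt ((i : ZMod n) - (s : ZMod n)) := by
      intro s hs
      rw [mem_range] at hs
      congr 1
      rw [eq_sub_iff_add_eq, ← Nat.cast_add, show i + (m + i - s) + s = i + n by omega]
      simp
    have e2 : ∀ s ∈ range m, xElt ((i + (m - s) : ℕ) : ZMod n) = xElt (-(s : ZMod n)) := by
      intro s hs
      rw [mem_range] at hs
      congr 1
      rw [eq_neg_iff_add_eq_zero, ← Nat.cast_add, show i + (m - s) + s = n by omega]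
      simp
    rw [prod_congr rfl e1, prod_congr rfl e2] at key
    exact key
  · intro p h1 h2 f
    rw [← add_assoc, Nat.cast_add_one]
    exact xElt_mul_demazureT hn _ f
  · intro p q h1 h2 h3 h4 h5 h6 f
    -- The index `q` may equal `n`, and then names the same class as position `0`.
    have h7 : ∀ r < n, q ≠ r → (q = n → r ≠ 0) →
        ((i + q : ℕ) : ZMod n) ≠ ((i + r : ℕ) : ZMod n) := by
      intro r hr hqr hqn
      rcases lt_or_ge q n with hq | hq
      · rwa [ne_eq, natCast_add_eq_iff hq hr]
      · obtain rfl : q = n := by omega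
        rw [show ((i + q : ℕ) : ZMod q) = ((i + 0 : ℕ) : ZMod q) by simp, ne_eq,
          natCast_add_eq_iff (by omega) hr]
        exact Ne.symm (hqn rfl)
    refine demazureD_xElt_mul hn (h7 p (by omega) h5 (by omega)) ?_ f
    rw [← Nat.cast_add_one, add_assoc]
    rcases (show p + 1 ≤ n by omega).lt_or_eq with h8 | h8
    · exact h7 (p + 1) h8 h6 (by omega)
    · rw [h8, show ((i + n : ℕ) : ZMod n) = ((i + 0 : ℕ) : ZMod n) by simp]
      exact h7 0 (by omega) (by omega) (by omega)

/-! ### Alternants and bialternants. -/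

/-- The antisymmetrization of an element of `Λ̂` over the permutations of the indices. -/
noncomputable def alternant [NeZero n] (u : LambdaHat n) : LambdaHat n :=
  ∑ w : Equiv.Perm (ZMod n), ((Equiv.Perm.sign w : ℤ) : LambdaHat n) * permHom w u

theorem alternant_add [NeZero n] (u v : LambdaHat n) :
    alternant (u + v) = alternant u + alternant v := by
  simp only [alternant, map_add, mul_add, sum_add_distrib]

theorem alternant_mul_of_invariant [NeZero n] {c : LambdaHat n} (hc : ∀ w, permHom w c = c)
    (u : LambdaHat n) : alternant (c * u) = c * alternant u := by
  simp only [alternant, map_mul, hc, mul_sum]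
  exact sum_congr rfl fun w _ => mul_left_comm _ _ _

theorem alternant_eq_zero [NeZero n] {u : LambdaHat n} {j k : ZMod n} (hjk : j ≠ k)
    (hu : permHom (Equiv.swap j k) u = u) : alternant u = 0 := by
  refine sum_involution (fun w _ => w * Equiv.swap j k) (fun w _ => ?_) (fun w _ _ h => ?_)
    (fun w _ => mem_univ _) (fun w _ => ?_)
  · rw [permHom_mul, hu, Equiv.Perm.sign_mul, Equiv.Perm.sign_swap hjk]
    push_cast
    ring
  · rw [mul_eq_left] at h
    exact hjk (Equiv.swap_eq_one_iff.1 h)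
  · simp [mul_assoc]

/-- The product `∏_k (-e^{-a_{i+1+k}})^k`. -/
noncomputable def staircase (n i : ℕ) : LambdaHat n :=
  ∏ k ∈ range n, (-xElt ((i + 1 + k : ℕ) : ZMod n)) ^ k

theorem swap_natCast_add {i q k : ℕ} (hq : q + 1 < n) (hk : k < n) :
    Equiv.swap ((i + 1 + q : ℕ) : ZMod n) (((i + 1 + q : ℕ) : ZMod n) + 1)
      ((i + 1 + k : ℕ) : ZMod n) = ((i + 1 + Equiv.swap q (q + 1) k : ℕ) : ZMod n) := by
  rw [← Nat.cast_add_one, add_assoc (i + 1) q 1, Equiv.swap_apply_def, Equiv.swap_apply_def]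
  simp only [natCast_add_eq_iff hk (show q < n by omega), natCast_add_eq_iff hk hq]
  split_ifs <;> rfl

/-- Only the factors `k = q` and `k = q + 1` change, and one power moves from the second variable to
the first. -/
theorem xElt_mul_permHom_staircase (i : ℕ) {q : ℕ} (hq : q + 1 < n) :
    xElt (((i + 1 + q : ℕ) : ZMod n) + 1) *
        permHom (Equiv.swap ((i + 1 + q : ℕ) : ZMod n) (((i + 1 + q : ℕ) : ZMod n) + 1))
          (staircase n i) =
      xElt ((i + 1 + q : ℕ) : ZMod n) * staircase n i := by
  have h1 : q ∈ range n := mem_range.2 (by omega)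
  have h2 : q + 1 ∈ (range n).erase q := mem_erase.2 ⟨by omega, mem_range.2 hq⟩
  rw [staircase, map_prod]
  simp only [map_pow, map_neg, permHom_xElt]
  have h3 : ∀ k ∈ range n, (-xElt (Equiv.swap ((i + 1 + q : ℕ) : ZMod n)
      (((i + 1 + q : ℕ) : ZMod n) + 1) ((i + 1 + k : ℕ) : ZMod n))) ^ k =
      (-xElt ((i + 1 + Equiv.swap q (q + 1) k : ℕ) : ZMod n)) ^ k := by
    intro k hk
    rw [swap_natCast_add hq (mem_range.1 hk)]
  rw [prod_congr rfl h3, ← mul_prod_erase _ _ h1, ← mul_prod_erase _ _ h2,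
    ← mul_prod_erase (range n) (fun k => (-xElt ((i + 1 + k : ℕ) : ZMod n)) ^ k) h1,
    ← mul_prod_erase ((range n).erase q) (fun k => (-xElt ((i + 1 + k : ℕ) : ZMod n)) ^ k) h2]
  have h4 : ∀ k ∈ ((range n).erase q).erase (q + 1),
      (-xElt ((i + 1 + Equiv.swap q (q + 1) k : ℕ) : ZMod n)) ^ k =
        (-xElt ((i + 1 + k : ℕ) : ZMod n)) ^ k := by
    intro k hk
    rw [mem_erase, mem_erase] at hk
    rw [Equiv.swap_apply_of_ne_of_ne hk.2.1 hk.1]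
  rw [prod_congr rfl h4, Equiv.swap_apply_left, Equiv.swap_apply_right, ← Nat.cast_add_one,
    add_assoc (i + 1) q 1]
  ring

theorem neg_natCast_of_add_eq {i m : ℕ} (him : i + m = n) : -(m : ZMod n) = (i : ZMod n) := by
  rw [neg_eq_iff_add_eq_zero, ← Nat.cast_add, add_comm, him, ZMod.natCast_self]

theorem natCast_add_succ_ne {i m q : ℕ} (him : i + m = n) (hq : q + 1 < n) :
    ((i + 1 + q : ℕ) : ZMod n) ≠ -(m : ZMod n) := by
  rw [neg_natCast_of_add_eq him, show i + 1 + q = i + (q + 1) by omega,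
    show (i : ZMod n) = ((i + 0 : ℕ) : ZMod n) by simp, ne_eq, natCast_add_eq_iff hq (by omega)]
  omega

/-- As `D_j = T_j + 1`, the `T_j` term must have zero alternant. The transposition multiplies `ξ T_j
f` by `x_{j+1} / x_j` and the staircase by `x_j / x_{j+1}`, so it fixes their product. -/
theorem alternant_staircase_mul_demazureD [NeZero n] (hn : 2 ≤ n) {i m q : ℕ} (hi : 1 ≤ i)
    (him : i + m = n) (hq : q + 1 < n) (f : LambdaHat n) :
    alternant (staircase n i * ((omegaProd n m : LambdaHat n) *
        demazureD ((i + 1 + q : ℕ) : ZMod n) f)) =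
      alternant (staircase n i * ((omegaProd n m : LambdaHat n) * f)) := by
  set j : ZMod n := ((i + 1 + q : ℕ) : ZMod n) with hj
  have hjm : j ≠ -(m : ZMod n) := natCast_add_succ_ne him hq
  rw [demazureD, mul_add, mul_add, alternant_add, add_eq_right]
  refine alternant_eq_zero (add_one_ne hn j).symm ?_
  have h0 := xElt_mul_permHom_staircase i hq
  rw [← hj] at h0
  set σ := Equiv.swap j (j + 1) with hσ
  have h1 := xElt_sub_mul_demazureT j f
  have h2 : (xElt j - xElt (j + 1)) * ((omegaProd n m : LambdaHat n) * demazureT j f) =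
      xElt j * (permHom σ ((omegaProd n m : LambdaHat n) * f) - (omegaProd n m : LambdaHat n) * f) := by
    rw [mul_left_comm, h1, ← omegaProd_mul_simpleRefl (by omega) hjm]
    ring
  set g := (omegaProd n m : LambdaHat n) * f
  set t := (omegaProd n m : LambdaHat n) * demazureT j f
  have h3 : permHom σ (permHom σ g) = g := by
    rw [← permHom_mul, hσ, Equiv.swap_mul_self, permHom_one]
  have h4 := congrArg (permHom σ) h2
  rw [map_mul (permHom σ) _ t, map_mul (permHom σ) (xElt j), map_sub, map_sub, permHom_xElt,
    permHom_xElt, h3, hσ,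
    Equiv.swap_apply_left, Equiv.swap_apply_right, ← hσ] at h4
  rw [map_mul]
  refine mul_left_cancel₀ (sub_ne_zero.2 (xElt_ne_xElt_succ hn j)) ?_
  linear_combination -permHom σ (staircase n i) * h4 - staircase n i * h2 -
    (g - permHom σ g) * h0

theorem alternant_heckeChain {B A : Type*} {d : ℕ → B → B} {J : B → A} {a k : ℕ}
    (h : ∀ p, a ≤ p → p < a + k → ∀ f, J (d p f) = J f) (f : B) :
    J (heckeChain d a k f) = J f := by
  induction k with
  | zero => rfl
  | succ k ih =>
    rw [heckeChain, h _ (by omega) (by omega), ih fun p h1 h2 => h p h1 (by omega)]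

theorem alternant_heckeRect {B A : Type*} {d : ℕ → B → B} {J : B → A} {m k t : ℕ} (ht : t ≤ m)
    (h : ∀ p, 1 ≤ p → p < m + k → ∀ f, J (d p f) = J f) (f : B) :
    J (heckeRect d m k t f) = J f := by
  induction t with
  | zero => rfl
  | succ t ih =>
    rw [heckeRect, alternant_heckeChain fun p h1 h2 => h p (by omega) (by omega), ih (by omega)]

theorem alternant_foldr_demazureD [NeZero n] (hn : 2 ≤ n) {i m : ℕ} (hi : 1 ≤ i)
    (him : i + m = n) (f : LambdaHat n) :
    alternant (staircase n i * ((omegaProd n m : LambdaHat n) *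
        (rectWord n i m).foldr demazureD f)) =
      alternant (staircase n i * ((omegaProd n m : LambdaHat n) * f)) := by
  rw [foldr_rectWord demazureD him le_rfl]
  refine alternant_heckeRect (J := fun f => alternant (staircase n i *
    ((omegaProd n m : LambdaHat n) * f))) le_rfl (fun p h1 h2 f => ?_) f
  obtain ⟨q, rfl⟩ : ∃ q, p = q + 1 := ⟨p - 1, by omega⟩
  rw [← add_assoc, Nat.add_right_comm]
  exact alternant_staircase_mul_demazureD hn hi him (by omega) f

/-- The indices `i + 1, …, i + n` in `ℤ/n`. -/
noncomputable def indexEquiv (n i : ℕ) [NeZero n] : Fin n ≃ ZMod n :=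
  Equiv.ofBijective (fun k => ((i + 1 + (k : ℕ) : ℕ) : ZMod n))
    ((Fintype.bijective_iff_injective_and_card _).2 ⟨fun k l h => Fin.ext
      ((natCast_add_eq_iff k.2 l.2).1 h), by rw [Fintype.card_fin, ZMod.card]⟩)

theorem indexEquiv_apply [NeZero n] (i : ℕ) (k : Fin n) :
    indexEquiv n i k = ((i + 1 + (k : ℕ) : ℕ) : ZMod n) := rfl

/-- The indices are ordered as `i + 1, …, i + n`; the `n - 1` adjacent transpositions generate all
permutations, so the node `i` is not needed. -/
theorem permHom_eq_self_of_swap [NeZero n] (i : ℕ) {f : LambdaHat n}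
    (hf : ∀ q, q + 1 < n → permHom (Equiv.swap ((i + 1 + q : ℕ) : ZMod n)
      (((i + 1 + q : ℕ) : ZMod n) + 1)) f = f) (w : Equiv.Perm (ZMod n)) : permHom w f = f := by
  obtain ⟨N, rfl⟩ : ∃ N, n = N + 1 := ⟨n - 1, by have := NeZero.pos n; omega⟩
  let S : Submonoid (Equiv.Perm (Fin (N + 1))) :=
    { carrier := {v | permHom ((indexEquiv (N + 1) i).permCongr v) f = f}
      one_mem' := by
        change permHom ((indexEquiv (N + 1) i).permCongr 1) f = f
        rw [show (indexEquiv (N + 1) i).permCongr 1 = 1 by ext; simp, permHom_one]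
      mul_mem' := by
        intro u v hu hv
        change permHom _ f = f at hu hv
        change permHom ((indexEquiv (N + 1) i).permCongr (u * v)) f = f
        rw [Equiv.permCongr_mul, permHom_mul, hv, hu] }
  have hS : S = ⊤ := by
    rw [← top_le_iff, ← Equiv.Perm.mclosure_swap_castSucc_succ, Submonoid.closure_le]
    rintro _ ⟨k, rfl⟩
    change permHom ((indexEquiv (N + 1) i).permCongr (Equiv.swap k.castSucc k.succ)) f = f
    have h1 := hf k (by omega)
    rw [Equiv.permCongr_def, Equiv.symm_trans_swap_trans, indexEquiv_apply, indexEquiv_apply]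
    rw [← Nat.cast_add_one] at h1
    exact h1
  have h2 : (indexEquiv (N + 1) i).permCongr.symm w ∈ S := hS ▸ Submonoid.mem_top _
  change permHom _ f = f at h2
  rwa [Equiv.apply_symm_apply] at h2

/-- By `rect_fixed` the element is in the image of each `D_j` with `j ≠ -m`, hence fixed by `s_j`,
and the product of `Ω`'s makes this invariance under an exchange of indices. -/
theorem permHom_omegaProd_mul_foldr [NeZero n] (hn : 2 ≤ n) {i m : ℕ} (hi : 1 ≤ i)
    (him : i + m = n) {f : LambdaHat n}
    (hf : ∀ j : ZMod n, j ≠ 0 → j ≠ -(m : ZMod n) → simpleRefl j f = f)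
    (w : Equiv.Perm (ZMod n)) :
    permHom w ((omegaProd n m : LambdaHat n) * (rectWord n i m).foldr demazureD f) =
      (omegaProd n m : LambdaHat n) * (rectWord n i m).foldr demazureD f := by
  refine permHom_eq_self_of_swap i (fun q hq => ?_) w
  set j : ZMod n := ((i + 1 + q : ℕ) : ZMod n) with hj
  have hjm : j ≠ -(m : ZMod n) := natCast_add_succ_ne him hq
  have sx : ∀ f, reflHom j (xElt j * f) = xElt (j + 1) * reflHom j f := fun f => by
    rw [reflHom_xElt_mul, Equiv.swap_apply_left]
  have sy : ∀ f, reflHom j (xElt (j + 1) * f) = xElt j * reflHom j f := fun f => by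
    rw [reflHom_xElt_mul, Equiv.swap_apply_right]
  have h1 : demazureD j ((rectWord n i m).foldr demazureD f) =
      (rectWord n i m).foldr demazureD f := by
    rw [foldr_rectWord demazureD him le_rfl, hj, Nat.add_right_comm i 1 q, add_assoc i q 1]
    refine (isZeroHecke_shiftedD hn i).rect_fixed (by omega) hi le_rfl (fun p h1 h2 h3 => ?_)
      (show 1 ≤ q + 1 by omega) hq (by omega)
    refine demazure_eq_self (xElt_ne_xElt_succ hn _) (reflHom _) (xElt_sub_mul_demazureD _) ?_
    refine hf _ ?_ ?_
    · have h4 : ((i + m : ℕ) : ZMod n) = 0 := by rw [him, ZMod.natCast_self]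
      rw [← h4, ne_eq, natCast_add_eq_iff h2 (by omega)]
      exact h3
    · rw [neg_natCast_of_add_eq him]
      intro h5
      have h6 : ((i + p : ℕ) : ZMod n) = ((i + 0 : ℕ) : ZMod n) := h5
      rw [natCast_add_eq_iff h2 (by omega)] at h6
      omega
  rw [← omegaProd_mul_simpleRefl (by omega) hjm, ← reflHom_apply]
  congr 1
  rw [← h1]
  exact demazure_fixed (xElt_ne_xElt_succ hn j) (reflHom j) sx sy (reflHom_reflHom hn j)
    (xElt_sub_mul_demazureD j) _

/-- The bialternant matrix with entries `(-e^{-a_j})^k`, multiplied by `φ_j` in the first `m`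
columns. -/
noncomputable def bialternant [NeZero n] (i m : ℕ) (φ : ZMod n → LambdaHat n) :
    Matrix (Fin n) (Fin n) (LambdaHat n) :=
  Matrix.of fun a k => (-xElt (indexEquiv n i a)) ^ (k : ℕ) *
    if (k : ℕ) < m then φ (indexEquiv n i a) else 1

/-- This is the Leibniz expansion. The first `m` columns belong to the indices `i + 1, …, n`, which
modulo `n` are `1 - m, …, 0`. -/
theorem det_bialternant [NeZero n] {i m : ℕ} (him : i + m = n) {φ : ZMod n → LambdaHat n}
    (hφ : ∀ w j, permHom w (φ j) = φ (w j)) :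
    (bialternant i m φ).det =
      alternant (staircase n i * ∏ r ∈ range m, φ (-(r : ZMod n))) := by
  have h1 : staircase n i * ∏ r ∈ range m, φ (-(r : ZMod n)) =
      ∏ k : Fin n, ((-xElt (indexEquiv n i k)) ^ (k : ℕ) *
        if (k : ℕ) < m then φ (indexEquiv n i k) else 1) := by
    rw [prod_mul_distrib, staircase, ← Fin.prod_univ_eq_prod_range]
    congr 1
    refine Eq.trans ?_ (Fin.prod_univ_eq_prod_range
      (fun k => if k < m then φ ((i + 1 + k : ℕ) : ZMod n) else 1) n).symm
    rw [← prod_filter, ← prod_range_reflect]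
    have h2 : (range n).filter (fun k => k < m) = range m := by
      ext k
      simp only [mem_filter, mem_range]
      omega
    rw [h2]
    refine prod_congr rfl fun r hr => ?_
    rw [mem_range] at hr
    congr 1
    rw [neg_eq_iff_add_eq_zero, ← Nat.cast_add, show m - 1 - r + (i + 1 + r) = n by omega,
      ZMod.natCast_self]
  rw [Matrix.det_apply', alternant, h1, ← (indexEquiv n i).permCongr.sum_comp]
  refine sum_congr rfl fun σ _ => ?_
  rw [Equiv.Perm.sign_permCongr, map_prod]
  congr 1
  refine prod_congr rfl fun k _ => ?_
  rw [map_mul, map_pow, map_neg, permHom_xElt, Equiv.permCongr_apply, Equiv.symm_apply_apply]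
  rw [bialternant, Matrix.of_apply]
  congr 1
  split_ifs
  · rw [hφ, Equiv.permCongr_apply, Equiv.symm_apply_apply]
  · rw [map_one]

theorem det_bialternant_one_ne_zero [NeZero n] (hn : 2 ≤ n) (i m : ℕ) :
    (bialternant (n := n) i m fun _ => 1).det ≠ 0 := by
  have h1 : bialternant (n := n) i m (fun _ => 1) =
      Matrix.vandermonde fun a => -xElt (indexEquiv n i a) := by
    ext a k
    simp [bialternant, Matrix.vandermonde_apply]
  have : Nontrivial (LambdaHat n) := ⟨_, _, xElt_ne_xElt_succ hn 0⟩
  rw [h1, Matrix.det_vandermonde, prod_ne_zero_iff]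
  intro a _
  rw [prod_ne_zero_iff]
  intro b hb
  rw [sub_ne_zero, ne_eq, neg_inj]
  intro h
  exact absurd ((indexEquiv n i).injective (xElt_injective hn h)) (mem_Ioi.1 hb).ne'

/-- The invariant factor is taken inside the alternant of the staircase, where the rectangle
operator can be dropped. -/
theorem omegaProd_mul_foldr_mul_det [NeZero n] (hn : 2 ≤ n) {i m : ℕ} (hi : 1 ≤ i)
    (him : i + m = n) {ψ : ZMod n → LambdaHat n} (hψ : ∀ w j, permHom w (ψ j) = ψ (w j)) :
    (omegaProd n m : LambdaHat n) *
        (rectWord n i m).foldr demazureD (∏ r ∈ range m, ψ (-(r : ZMod n))) *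
        (bialternant (n := n) i m fun _ => 1).det =
      (bialternant (n := n) i m fun j => (Omega (bpar j) : LambdaHat n) * ψ j).det := by
  rw [det_bialternant him (fun w j => map_one _), det_bialternant him (fun w j => by
    rw [map_mul, permHom_Omega, hψ]), prod_mul_distrib, ← coe_omegaProd,
    ← alternant_foldr_demazureD hn hi him, mul_comm (staircase n i) (_ * _),
    alternant_mul_of_invariant (permHom_omegaProd_mul_foldr hn hi him fun j h1 h2 => ?_)]
  · simp
  · rw [simpleRefl, if_neg h1, ← permHom_apply]
    exact permHom_swap_prod_range hψ (by omega) h2 h1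

/-! ### The matrix `Ω(1 - A|y)` and its entries. -/

/-- The symmetric power series whose coefficient at every monomial of degree `d` is `c d`. -/
noncomputable def degSeries (c : ℕ → RT n) : LambdaHat n :=
  ⟨fun m => c m.degree, fun π => by
    ext1 m
    refine (coeff_renameEquiv π _ m).trans ?_
    change c (m.mapDomain π.symm).degree = c m.degree
    congr 1
    exact Finsupp.degree_mapDomain _ _⟩

theorem degSeries_pow (c : RT n) : degSeries (fun d => c ^ d) = (Omega c : LambdaHat n) := rfl

theorem degSeries_zero : degSeries (fun _ => (0 : RT n)) = 0 := rfl

theorem degSeries_sub (c c' : ℕ → RT n) :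
    degSeries (fun d => c d - c' d) = degSeries c - degSeries c' := rfl

theorem degSeries_smul (r : RT n) (c : ℕ → RT n) :
    degSeries (fun d => r * c d) = algebraMap (RT n) (LambdaHat n) r * degSeries c := by
  rw [← Algebra.smul_def]
  rfl

theorem degSeries_sum {ι : Type*} (s : Finset ι) (c : ι → ℕ → RT n) :
    degSeries (fun d => ∑ k ∈ s, c k d) = ∑ k ∈ s, degSeries (c k) := by
  classical
  induction s using Finset.induction_on with
  | empty => simp [degSeries_zero]
  | insert a s ha ih =>
    rw [sum_insert ha, ← ih]
    simp only [sum_insert ha]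
    rfl

theorem permHom_degSeries (w : Equiv.Perm (ZMod n)) (c : ℕ → RT n) :
    permHom w (degSeries c) = degSeries fun d => permRT w (c d) := rfl

/-- The matrix `Ω(1 - A|y)`. -/
noncomputable def omegaMat (n : ℕ) : Matrix (Fin n) (Fin n) (LambdaHat n) :=
  Matrix.of fun a b => degSeries fun d => ((1 - matA n) ^ d) a b

/-- The matrix `A` over `Λ̂`. -/
noncomputable def matA' (n : ℕ) : Matrix (Fin n) (Fin n) (LambdaHat n) :=
  (matA n).map (algebraMap (RT n) (LambdaHat n))

/-- The matrix `P` over `Λ̂`. -/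
noncomputable def matP' (n : ℕ) : Matrix (Fin n) (Fin n) (LambdaHat n) :=
  (matP n).map (algebraMap (RT n) (LambdaHat n))

theorem matA'_mul_omegaMat : matA' n * omegaMat n = omegaMat n * matA' n := by
  ext1 a b
  rw [Matrix.mul_apply, Matrix.mul_apply]
  have h1 : ∀ k, matA' n a k * omegaMat n k b =
      degSeries fun d => matA n a k * ((1 - matA n) ^ d) k b := fun k =>
    (degSeries_smul (matA n a k) fun d => ((1 - matA n) ^ d) k b).symm
  have h2 : ∀ k, omegaMat n a k * matA' n k b =
      degSeries fun d => ((1 - matA n) ^ d) a k * matA n k b := fun k =>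
    (mul_comm _ _).trans ((degSeries_smul (matA n k b) fun d => ((1 - matA n) ^ d) a k).symm.trans
      (congrArg degSeries (funext fun d => mul_comm _ _)))
  simp only [h1, h2, ← degSeries_sum, ← Matrix.mul_apply]
  have h3 : ∀ d, matA n * (1 - matA n) ^ d = (1 - matA n) ^ d * matA n := fun d =>
    ((Commute.one_right (matA n)).sub_right (Commute.refl _)).pow_right d
  simp only [h3]

/-- The condition `f n = 0` makes the last row, which has no superdiagonal entry, obey the same
formula. -/
theorem matA_mulVec {f : ℕ → RT n} (hf : f n = 0) (a : Fin n) :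
    ∑ b, matA n a b * f b = exNeg n ((a : ℕ) + 1) * f a - f ((a : ℕ) + 1) := by
  have h1 : ∀ b : Fin n, matA n a b * f b = (if b = a then exNeg n ((a : ℕ) + 1) * f a else 0) -
      (if (b : ℕ) = (a : ℕ) + 1 then f ((a : ℕ) + 1) else 0) := by
    intro b
    rw [matA, Matrix.of_apply]
    by_cases h2 : b = a
    · subst h2
      rw [if_pos rfl, if_pos rfl, if_neg (by omega), sub_zero]
    · rw [if_neg h2, if_neg h2]
      split_ifs with h3
      · rw [h3]; ring
      · ring
  simp only [h1, sum_sub_distrib, sum_ite_eq', mem_univ, if_true]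
  congr 1
  by_cases h2 : (a : ℕ) + 1 < n
  · have h3 : ∀ b : Fin n, ((b : ℕ) = (a : ℕ) + 1) ↔ b = ⟨(a : ℕ) + 1, h2⟩ := fun b => by
      rw [Fin.ext_iff]
    simp only [h3, sum_ite_eq', mem_univ, if_true]
  · have h4 : (a : ℕ) + 1 = n := by omega
    rw [h4, hf]
    simp

/-- The complete homogeneous symmetric polynomials of the `b_p, …, b_q`, as the entries of the powers
of `1 - A`. -/
noncomputable def powEntry (n : ℕ) : ℕ → ℕ → ℕ → RT n
  | 0, p, q => if p = q then 1 else 0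
  | d + 1, p, q => bpar (p : ZMod n) * powEntry n d p q + powEntry n d (p + 1) q

theorem powEntry_of_lt {d p q : ℕ} (h : q < p) : powEntry n d p q = 0 := by
  induction d generalizing p with
  | zero => rw [powEntry, if_neg (by omega)]
  | succ d ih => rw [powEntry, ih h, ih (by omega), mul_zero, add_zero]

theorem powEntry_self (d p : ℕ) : powEntry n d p p = bpar (p : ZMod n) ^ d := by
  induction d with
  | zero => rw [powEntry, if_pos rfl, pow_zero]
  | succ d ih => rw [powEntry, ih, powEntry_of_lt (Nat.lt_succ_self p), add_zero, pow_succ']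

theorem pow_one_sub_matA_apply (d : ℕ) (a b : Fin n) :
    ((1 - matA n) ^ d) a b = powEntry n d ((a : ℕ) + 1) ((b : ℕ) + 1) := by
  induction d generalizing a with
  | zero => simp [powEntry, Matrix.one_apply, Fin.ext_iff]
  | succ d ih =>
    rw [pow_succ', sub_mul, one_mul, Matrix.sub_apply, Matrix.mul_apply]
    simp only [ih]
    rw [matA_mulVec (f := fun k => powEntry n d (k + 1) ((b : ℕ) + 1))
      (powEntry_of_lt (by omega)), powEntry, bpar, exNeg]
    ring

/-- The divided difference of a complete homogeneous polynomial in its last variable, by induction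
on the degree. For `p < q` the variable `b_p` is untouched by the transposition, as `q + 1 < p + n`;
for `p = q` this is the geometric sum identity. -/
theorem sub_mul_powEntry (hn : 2 ≤ n) {d p q : ℕ} (hpq : p ≤ q) (hq : q + 1 < p + n) :
    (exNeg n q - exNeg n (q + 1)) * powEntry n d p (q + 1) =
      permRT (Equiv.swap (q : ZMod n) ((q : ZMod n) + 1)) (powEntry n d p q) - powEntry n d p q := by
  have hb : exNeg n q - exNeg n (q + 1) = bpar ((q + 1 : ℕ) : ZMod n) - bpar (q : ZMod n) := by
    simp only [exNeg, bpar]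
    ring
  induction d generalizing p with
  | zero =>
    simp only [powEntry]
    rw [if_neg (by omega)]
    split_ifs <;> simp
  | succ d ih =>
    rcases hpq.lt_or_eq with h1 | rfl
    · have h2 : permRT (Equiv.swap (q : ZMod n) ((q : ZMod n) + 1)) (bpar (p : ZMod n)) =
          bpar (p : ZMod n) := by
        rw [permRT_bpar, Equiv.swap_apply_of_ne_of_ne]
        · obtain ⟨e, rfl⟩ : ∃ e, q = p + e := ⟨q - p, by omega⟩
          have := natCast_add_eq_iff (n := n) (i := p) (p := 0) (q := e) (by omega) (by omega)
          rw [add_zero] at this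
          rw [ne_eq, this]
          omega
        · obtain ⟨e, rfl⟩ : ∃ e, q = p + e := ⟨q - p, by omega⟩
          have := natCast_add_eq_iff (n := n) (i := p) (p := 0) (q := e + 1) (by omega) (by omega)
          rw [add_zero, ← add_assoc, Nat.cast_add_one] at this
          rw [ne_eq, this]
          omega
      rw [powEntry, powEntry, map_add, map_mul, h2]
      linear_combination bpar (p : ZMod n) * ih hpq hq + ih (p := p + 1) h1 (by omega)
    · have h3 := ih le_rfl hq
      rw [powEntry_self, map_pow, permRT_bpar, Equiv.swap_apply_left] at h3 ⊢
      rw [powEntry, powEntry_self]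
      rw [hb] at h3 ⊢
      push_cast at h3 ⊢
      linear_combination bpar (p : ZMod n) * h3

/-- The signed divided difference of `Ω(1 - t|y)` at `e^{-a_p}, …, e^{-a_q}`. -/
noncomputable def omegaEntry (n p q : ℕ) : LambdaHat n := degSeries fun d => powEntry n d p q

theorem omegaMat_apply (a b : Fin n) :
    omegaMat n a b = omegaEntry n ((a : ℕ) + 1) ((b : ℕ) + 1) := by
  simp only [omegaMat, Matrix.of_apply, pow_one_sub_matA_apply, omegaEntry]

theorem omegaEntry_self (p : ℕ) : omegaEntry n p p = (Omega (bpar (p : ZMod n)) : LambdaHat n) := by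
  simp only [omegaEntry, powEntry_self, degSeries_pow]

theorem omegaEntry_of_lt {p q : ℕ} (h : q < p) : omegaEntry n p q = 0 := by
  simp only [omegaEntry, powEntry_of_lt h, degSeries_zero]

theorem sub_mul_omegaEntry (hn : 2 ≤ n) {p q : ℕ} (hpq : p ≤ q) (hq : q + 1 < p + n) :
    (xElt (q : ZMod n) - xElt ((q : ZMod n) + 1)) * omegaEntry n p (q + 1) =
      permHom (Equiv.swap (q : ZMod n) ((q : ZMod n) + 1)) (omegaEntry n p q) -
        omegaEntry n p q := by
  rw [omegaEntry, omegaEntry, permHom_degSeries, ← degSeries_sub]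
  simp only [← sub_mul_powEntry hn hpq hq]
  rw [degSeries_smul, map_sub, exNeg, exNeg, Nat.cast_add_one]
  rfl

theorem zImage_self [NeZero n] (hn : 2 ≤ n) (i : ℕ) :
    zImage (n := n) i i = (Omega (bpar (i : ZMod n)) : LambdaHat n) := by
  rw [zImage, Ico_self, sum_empty, ex_zero, one_smul, Nat.sub_self, kSchur_rho hn (by omega),
    shiftPar, ← permHom_apply]
  simp [rhoWord]

/-- The factor `Ω(b_0)` is `omegaProd n 1`, which straightens `s_l` because `l ≠ -1`. -/
theorem omega_mul_kSchur_rho_succ [NeZero n] (hn : 2 ≤ n) {l : ℕ} (hl : l + 1 < n) :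
    (xElt (l : ZMod n) - xElt ((l : ZMod n) + 1)) *
        ((Omega (bpar (0 : ZMod n)) : LambdaHat n) * kSchur (rho n (l + 1))) =
      xElt (l : ZMod n) * (permHom (Equiv.swap (l : ZMod n) ((l : ZMod n) + 1))
          ((Omega (bpar (0 : ZMod n)) : LambdaHat n) * kSchur (rho n l)) -
        (Omega (bpar (0 : ZMod n)) : LambdaHat n) * kSchur (rho n l)) := by
  have h1 : kSchur (rho n (l + 1)) = demazureT (l : ZMod n) (kSchur (rho n l)) := by
    rw [kSchur_rho hn hl, kSchur_rho hn (by omega), rhoWord, List.range_succ, List.reverse_append,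
      List.reverse_singleton, List.singleton_append, List.map_cons, List.foldr_cons, rhoWord]
  have h2 : (Omega (bpar (0 : ZMod n)) : LambdaHat n) = (omegaProd n 1 : LambdaHat n) := by
    simp [omegaProd]
  have h3 : (l : ZMod n) ≠ -((1 : ℕ) : ZMod n) := by
    rw [ne_eq, eq_neg_iff_add_eq_zero, ← Nat.cast_add, ← Nat.cast_zero,
      natCast_injOn_zmod hl (by omega)]
    omega
  rw [h1, mul_left_comm, xElt_sub_mul_demazureT, h2, ← omegaProd_mul_simpleRefl (by omega) h3]
  ring

/-- The previous recursion shifted by `i`. The exponential in `a_i, …, a_{j-1}` is invariant under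
the transposition, and the new factor `e^{a_j}` cancels the `e^{-a_j}` produced by `T`. -/
theorem sub_mul_zImage [NeZero n] (hn : 2 ≤ n) {i j : ℕ} (hij : i ≤ j) (hj : j + 1 < i + n) :
    (xElt (j : ZMod n) - xElt ((j : ZMod n) + 1)) * zImage i (j + 1) =
      permHom (Equiv.swap (j : ZMod n) ((j : ZMod n) + 1)) (zImage i j) - zImage i j := by
  obtain ⟨l, rfl⟩ : ∃ l, j = i + l := ⟨j - i, by omega⟩
  have h1 := congrArg (permHom (Equiv.addRight (i : ZMod n)))
    (omega_mul_kSchur_rho_succ hn (l := l) (by omega))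
  have h2 : ∀ f : LambdaHat n, permHom (Equiv.addRight (i : ZMod n))
      (permHom (Equiv.swap (l : ZMod n) ((l : ZMod n) + 1)) f) =
      permHom (Equiv.swap ((i + l : ℕ) : ZMod n) (((i + l : ℕ) : ZMod n) + 1))
        (permHom (Equiv.addRight (i : ZMod n)) f) := by
    intro f
    rw [← permHom_mul, ← permHom_mul, Equiv.mul_swap_eq_swap_mul]
    congr 3
    simp only [Equiv.coe_addRight]
    push_cast
    congr 1 <;> ring
  have h3 : ∀ k, zImage (n := n) i (i + k) = algebraMap (RT n) (LambdaHat n)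
      (ex (∑ t ∈ Ico i (i + k), wt (t : ZMod n))) * permHom (Equiv.addRight (i : ZMod n))
        ((Omega (bpar (0 : ZMod n)) : LambdaHat n) * kSchur (rho n k)) := by
    intro k
    rw [zImage, Algebra.smul_def, map_mul, permHom_Omega,
      show Equiv.addRight (i : ZMod n) 0 = i from zero_add _, shiftPar,
      ← permHom_apply, Nat.add_sub_cancel_left]
  have h6 : Equiv.addRight (i : ZMod n) (l : ZMod n) = ((i + l : ℕ) : ZMod n) := by
    rw [Nat.cast_add, add_comm (i : ZMod n)]
    rfl
  have h7 : Equiv.addRight (i : ZMod n) ((l : ZMod n) + 1) = ((i + l : ℕ) : ZMod n) + 1 := by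
    rw [← h6]
    exact add_right_comm _ _ _
  rw [map_mul _ (xElt (l : ZMod n) - _) _, map_mul _ (xElt (l : ZMod n)) _, map_sub, map_sub, h2,
    permHom_xElt, permHom_xElt, h6, h7] at h1
  have h4 : permRT (Equiv.swap ((i + l : ℕ) : ZMod n) (((i + l : ℕ) : ZMod n) + 1))
      (ex (∑ t ∈ Ico i (i + l), wt (t : ZMod n))) = ex (∑ t ∈ Ico i (i + l), wt (t : ZMod n)) := by
    rw [permRT_ex, map_sum]
    congr 1
    refine sum_congr rfl fun t ht => ?_
    rw [mem_Ico] at ht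
    obtain ⟨e, rfl⟩ : ∃ e, t = i + e := ⟨t - i, by omega⟩
    rw [permWeight_wt, Equiv.swap_apply_of_ne_of_ne]
    · rw [ne_eq, natCast_add_eq_iff (by omega) (by omega)]
      omega
    · rw [← Nat.cast_add_one, add_assoc, ne_eq, natCast_add_eq_iff (by omega) (by omega)]
      omega
  have h5 : algebraMap (RT n) (LambdaHat n) (ex (wt ((i + l : ℕ) : ZMod n))) *
      xElt ((i + l : ℕ) : ZMod n) = 1 := by
    rw [xElt, ← map_mul, ← ex_add, add_neg_cancel, ex_zero, map_one]
  rw [add_assoc, h3, h3, map_mul (permHom (Equiv.swap _ _)), permHom_algebraMap, h4, ← add_assoc,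
    sum_Ico_succ_top (by omega), ex_add, map_mul]
  set c := algebraMap (RT n) (LambdaHat n) (ex (∑ t ∈ Ico i (i + l), wt (t : ZMod n)))
  set e := algebraMap (RT n) (LambdaHat n) (ex (wt ((i + l : ℕ) : ZMod n)))
  linear_combination c * e * h1 + c * (permHom (Equiv.swap ((i + l : ℕ) : ZMod n)
    (((i + l : ℕ) : ZMod n) + 1)) (permHom (Equiv.addRight (i : ZMod n))
      ((Omega (bpar (0 : ZMod n)) : LambdaHat n) * kSchur (rho n l))) -
      permHom (Equiv.addRight (i : ZMod n))
      ((Omega (bpar (0 : ZMod n)) : LambdaHat n) * kSchur (rho n l))) * h5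

/-- Both families start at `Ω(b_i|y)` and satisfy the same divided difference recursion in `j`. -/
theorem zImage_eq_omegaEntry [NeZero n] (hn : 2 ≤ n) {i j : ℕ} (hij : i ≤ j) (hj : j < i + n) :
    zImage i j = omegaEntry n i j := by
  induction j, hij using Nat.le_induction with
  | base => rw [zImage_self hn, omegaEntry_self]
  | succ j hij ih =>
    refine mul_left_cancel₀ (sub_ne_zero.2 (xElt_ne_xElt_succ hn (j : ZMod n))) ?_
    rw [sub_mul_zImage hn hij hj, sub_mul_omegaEntry hn hij hj, ih (by omega)]

/-! ### Leading minors as ratios of alternants. -/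

/-- The leading principal minors of a matrix, as determinants of the matrix with the remaining rows
replaced by those of the identity matrix. -/
theorem leadingMinor_eq_det {R : Type*} [CommRing R] (X : Matrix (Fin n) (Fin n) R) {m : ℕ}
    (hm : m ≤ n) : leadingMinor X m hm =
      (Matrix.of fun a b : Fin n => if (a : ℕ) < m then X a b else if a = b then 1 else 0).det := by
  rw [Matrix.twoBlockTriangular_det _ (fun a : Fin n => (a : ℕ) < m)]
  · let e : Fin m ≃ {a : Fin n // (a : ℕ) < m} :=
      { toFun := fun k => ⟨Fin.castLE hm k, k.2⟩
        invFun := fun a => ⟨a.1, a.2⟩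
        left_inv := fun k => rfl
        right_inv := fun a => rfl }
    have h1 : ∀ M : Matrix (Fin n) (Fin n) R,
        (M.toSquareBlockProp fun a => (a : ℕ) < m).det =
          (M.submatrix (Fin.castLE hm) (Fin.castLE hm)).det := fun M =>
      (Matrix.det_submatrix_equiv_self e _).symm
    have h2 : (Matrix.of fun a b : Fin n =>
        if (a : ℕ) < m then X a b else if a = b then (1 : R) else 0).toSquareBlockProp
          (fun a => ¬ (a : ℕ) < m) = 1 := by
      ext ⟨a, ha⟩ ⟨b, hb⟩
      simp [Matrix.toSquareBlockProp, Matrix.one_apply, ha]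
    rw [h1, h2, Matrix.det_one, mul_one, leadingMinor]
    congr 1
    ext k l
    simp
  · intro a ha b hb
    rw [Matrix.of_apply, if_neg ha, if_neg]
    rintro rfl
    exact ha hb

theorem map_leadingMinor {R S : Type*} [CommRing R] [CommRing S] (φ : R →+* S)
    (X : Matrix (Fin n) (Fin n) R) {m : ℕ} (hm : m ≤ n) :
    φ (leadingMinor X m hm) = leadingMinor (X.map φ) m hm := by
  rw [leadingMinor, leadingMinor, RingHom.map_det]
  rfl

/-- The values at `e^{-a_j}` of the Newton basis `∏_{s ≤ k} (e^{-a_s} - t)`. -/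
noncomputable def newton (n : ℕ) (j : ZMod n) (k : ℕ) : RT n :=
  ∏ s ∈ range k, (exNeg n (s + 1) - ex (-wt j))

/-- The index `j` occurs among `1, …, n`. This vanishing is the boundary condition that makes the
Newton values an eigenvector of `A`. -/
theorem newton_self [NeZero n] (j : ZMod n) : newton n j n = 0 := by
  refine prod_eq_zero (i := (j - 1).val) (mem_range.2 (ZMod.val_lt _)) ?_
  rw [exNeg, Nat.cast_add_one, ZMod.natCast_zmod_val, sub_add_cancel, sub_self]

theorem matA_mulVec_newton [NeZero n] (j : ZMod n) (a : Fin n) :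
    ∑ b, matA n a b * newton n j b = ex (-wt j) * newton n j a := by
  rw [matA_mulVec (newton_self j), newton, newton, prod_range_succ]
  ring

theorem pow_one_sub_matA_mulVec_newton [NeZero n] (j : ZMod n) (d : ℕ) (a : Fin n) :
    ∑ b, ((1 - matA n) ^ d) a b * newton n j b = bpar j ^ d * newton n j a := by
  have h1 : (1 - matA n).mulVec (fun b => newton n j b) = bpar j • fun b : Fin n => newton n j b := by
    ext a
    rw [Matrix.sub_mulVec, Matrix.one_mulVec, Pi.sub_apply, Pi.smul_apply, smul_eq_mul, bpar]
    change _ - ∑ b, matA n a b * newton n j b = _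
    rw [matA_mulVec_newton]
    ring
  have h2 : ((1 - matA n) ^ d).mulVec (fun b => newton n j b) =
      (bpar j ^ d) • fun b : Fin n => newton n j b := by
    induction d with
    | zero => simp
    | succ d ih =>
      rw [pow_succ, ← Matrix.mulVec_mulVec, h1, Matrix.mulVec_smul, ih, smul_smul, pow_succ']
  exact congrFun h2 a

/-- Vieta's formula for `∏_{s ≤ a} (X + e^{-a_s})`, evaluated at `X = -e^{-a_j}`. -/
theorem matP_mulVec (j : ZMod n) (a : Fin n) :
    ∑ b : Fin n, matP n a b * (-ex (-wt j)) ^ (b : ℕ) = newton n j a := by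
  have h1 : ∀ b : Fin n, matP n a b * (-ex (-wt j)) ^ (b : ℕ) =
      if (b : ℕ) < (a : ℕ) + 1 then elemSymm n a ((a : ℕ) - b) * (-ex (-wt j)) ^ (b : ℕ) else 0 := by
    intro b
    rw [matP, Matrix.of_apply]
    by_cases h : b ≤ a
    · rw [if_pos h, if_pos (Nat.lt_succ_of_le h)]
    · rw [if_neg h, if_neg (fun h' => h (Nat.le_of_lt_succ h')), zero_mul]
  simp only [h1]
  rw [Fin.sum_univ_eq_sum_range (fun b => if b < (a : ℕ) + 1 then
    elemSymm n a ((a : ℕ) - b) * (-ex (-wt j)) ^ b else 0), ← sum_filter]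
  have h2 : (range n).filter (fun b => b < (a : ℕ) + 1) = range ((a : ℕ) + 1) := by
    ext b
    simp only [mem_filter, mem_range]
    omega
  rw [h2, ← sum_range_reflect]
  have h3 := congrArg (Polynomial.eval (-ex (-wt j)))
    (Multiset.prod_X_add_C_eq_sum_esymm ((Multiset.range a).map fun s => exNeg n (s + 1)))
  rw [Polynomial.eval_finsetSum, Polynomial.eval_multiset_prod, Multiset.map_map, Multiset.map_map,
    Multiset.card_map, Multiset.card_range] at h3
  simp only [Polynomial.eval_mul, Polynomial.eval_C, Polynomial.eval_pow, Polynomial.eval_X,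
    Function.comp_def, Polynomial.eval_add] at h3
  have h4 : newton n j a = ((Multiset.range a).map fun s =>
      -ex (-wt j) + exNeg n (s + 1)).prod := by
    rw [newton]
    refine (prod_congr rfl fun s _ => ?_ : _ = ∏ s ∈ range a, (-ex (-wt j) + exNeg n (s + 1)))
    ring
  rw [h4, h3]
  refine sum_congr rfl fun s hs => ?_
  rw [mem_range] at hs
  rw [elemSymm, show (a : ℕ) + 1 - 1 - s = a - s by omega, show (a : ℕ) - (a - s) = s by omega]

/-- If the vectors of values of the Newton basis are eigenvectors of `Y`, the leading minors of
`Y P` are ratios of alternants. -/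
theorem leadingMinor_mul_det [NeZero n] (i : ℕ) {m : ℕ} (hm : m ≤ n)
    {Y : Matrix (Fin n) (Fin n) (LambdaHat n)} {φ : ZMod n → LambdaHat n}
    (hY : ∀ j a, ∑ b, Y a b * algebraMap (RT n) (LambdaHat n) (newton n j b) =
      φ j * algebraMap (RT n) (LambdaHat n) (newton n j a)) :
    leadingMinor (Y * matP' n) m hm * (bialternant (n := n) i m fun _ => 1).det =
      (bialternant i m φ).det := by
  set S : Matrix (Fin n) (Fin n) (LambdaHat n) := Matrix.of fun a b =>
    if (a : ℕ) < m then (Y * matP' n) a b else if a = b then 1 else 0 with hS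
  set Q : Matrix (Fin n) (Fin n) (LambdaHat n) := Matrix.of fun a b =>
    if (a : ℕ) < m then matP' n a b else if a = b then 1 else 0 with hQ
  have hP : ∀ j a, ∑ b : Fin n, matP' n a b * (-xElt j) ^ (b : ℕ) =
      algebraMap (RT n) (LambdaHat n) (newton n j a) := by
    intro j a
    rw [← matP_mulVec, map_sum]
    refine sum_congr rfl fun b _ => ?_
    rw [map_mul, map_pow, map_neg]
    rfl
  -- In the rows `a < m` the lower triangular `P` involves only columns `b < m`, exactly those where
  -- the bialternant carries `φ_j`. In the remaining rows both products pick out the untouched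
  -- columns. As `Q` is unitriangular, determinants give the claim.
  have h1 : S * (bialternant (n := n) i m fun _ => 1).transpose =
      Q * (bialternant i m φ).transpose := by
    ext1 a c
    rw [Matrix.mul_apply, Matrix.mul_apply]
    simp only [Matrix.transpose_apply, bialternant, Matrix.of_apply, ite_self, mul_one, hS, hQ]
    by_cases ha : (a : ℕ) < m
    · simp only [if_pos ha]
      set j := indexEquiv n i c
      have h2 : ∑ b, (Y * matP' n) a b * (-xElt j) ^ (b : ℕ) =
          φ j * algebraMap (RT n) (LambdaHat n) (newton n j a) := by
        rw [← hY]
        simp only [Matrix.mul_apply, sum_mul, mul_assoc]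
        rw [sum_comm]
        refine sum_congr rfl fun k _ => ?_
        rw [← mul_sum, hP]
      rw [h2, ← hP, mul_sum]
      refine sum_congr rfl fun b _ => ?_
      by_cases hb : (b : ℕ) < m
      · rw [if_pos hb]
        ring
      · have h3 : matP' n a b = 0 := by
          rw [matP', Matrix.map_apply, matP, Matrix.of_apply, if_neg, map_zero]
          intro h4
          have : (b : ℕ) ≤ a := h4
          omega
        rw [h3]
        ring
    · simp only [if_neg ha]
      rw [sum_eq_single a (fun b _ hb => by rw [if_neg hb.symm, zero_mul]) (by simp),
        sum_eq_single a (fun b _ hb => by rw [if_neg hb.symm, zero_mul]) (by simp), if_neg ha, mul_one]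
  have h2 : Q.det = 1 := by
    rw [Matrix.det_of_isLowerTriangular]
    · refine prod_eq_one fun a _ => ?_
      simp [hQ, matP', matP, elemSymm, Multiset.esymm]
    · intro a b hab
      have hab' : a < b := hab
      simp only [hQ, Matrix.of_apply, if_neg hab'.ne, matP', Matrix.map_apply, matP,
        if_neg (not_le.2 hab'), map_zero, ite_self]
  have h3 := congrArg Matrix.det h1
  rw [Matrix.det_mul, Matrix.det_mul, Matrix.det_transpose, Matrix.det_transpose, h2, one_mul] at h3
  rw [leadingMinor_eq_det]
  exact h3

theorem omegaMat_mulVec_newton [NeZero n] (j : ZMod n) (a : Fin n) :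
    ∑ b, omegaMat n a b * algebraMap (RT n) (LambdaHat n) (newton n j b) =
      (Omega (bpar j) : LambdaHat n) * algebraMap (RT n) (LambdaHat n) (newton n j a) := by
  have h1 : ∀ b, omegaMat n a b * algebraMap (RT n) (LambdaHat n) (newton n j b) =
      degSeries fun d => ((1 - matA n) ^ d) a b * newton n j b := fun b =>
    (mul_comm _ _).trans ((degSeries_smul (newton n j b) fun d => ((1 - matA n) ^ d) a b).symm.trans
      (congrArg degSeries (funext fun d => mul_comm _ _)))
  simp only [h1]
  rw [← degSeries_sum]
  simp only [pow_one_sub_matA_mulVec_newton]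
  rw [mul_comm, ← degSeries_pow, ← degSeries_smul]
  simp only [mul_comm (bpar j ^ _)]

theorem omegaMat_mul_matA'_mulVec_newton [NeZero n] (j : ZMod n) (a : Fin n) :
    ∑ b, (omegaMat n * matA' n) a b * algebraMap (RT n) (LambdaHat n) (newton n j b) =
      (Omega (bpar j) : LambdaHat n) * xElt j * algebraMap (RT n) (LambdaHat n) (newton n j a) := by
  have h1 : ∀ k, ∑ b, matA' n k b * algebraMap (RT n) (LambdaHat n) (newton n j b) =
      xElt j * algebraMap (RT n) (LambdaHat n) (newton n j k) := by
    intro k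
    rw [xElt, ← map_mul, ← matA_mulVec_newton, map_sum]
    refine sum_congr rfl fun b _ => ?_
    rw [map_mul]
    rfl
  simp only [Matrix.mul_apply, sum_mul, mul_assoc]
  rw [sum_comm]
  simp only [← mul_sum, h1]
  rw [mul_left_comm, ← omegaMat_mulVec_newton, mul_sum]
  exact sum_congr rfl fun k _ => mul_left_comm _ _ _

/-! ### The homomorphism `β` and the comparison of both sides. -/

/-- The values in `Λ̂` of the generators `z_{ij}` and `z_{ii}⁻¹`. -/
noncomputable def genImage (n : ℕ) : ZGen n → LambdaHat n :=
  Sum.elim (fun p => omegaMat n p.1.1 p.1.2)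
    (fun a => (((Omega (bpar (((a : ℕ) + 1 : ℕ) : ZMod n)))⁻¹ : (LambdaHat n)ˣ) : LambdaHat n))

theorem map_aeval_freeZ : (freeZ n).map (MvPolynomial.aeval (genImage n)) = omegaMat n := by
  ext1 a b
  rw [Matrix.map_apply, freeZ, Matrix.of_apply]
  split_ifs with h
  · rw [MvPolynomial.aeval_X]
    rfl
  · rw [map_zero, omegaMat_apply, omegaEntry_of_lt]
    have : b < a := not_le.1 h
    have : (b : ℕ) < a := this
    omega

theorem relZ_le_ker : ∀ f ∈ relZ n, MvPolynomial.aeval (genImage n) f = 0 := by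
  have h1 : relZ n ≤ RingHom.ker (MvPolynomial.aeval (R := RT n) (genImage n)).toRingHom := by
    rw [relZ, Ideal.span_le]
    rintro _ (⟨p, rfl⟩ | ⟨a, rfl⟩)
    · have h2 : (commZ n).map (MvPolynomial.aeval (genImage n)) = 0 := by
        have h3 : ((matA n).map MvPolynomial.C).map (MvPolynomial.aeval (genImage n)) = matA' n := by
          ext1 a b
          rw [Matrix.map_apply, Matrix.map_apply, MvPolynomial.aeval_C, matA', Matrix.map_apply]
        rw [commZ, Matrix.map_sub _ (map_sub _), Matrix.map_mul, Matrix.map_mul, h3, map_aeval_freeZ,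
          matA'_mul_omegaMat, sub_self]
      exact congrFun (congrFun h2 p.1) p.2
    · change MvPolynomial.aeval (genImage n) _ = 0
      have h2 : MvPolynomial.aeval (genImage n) (freeZ n a a) = omegaMat n a a :=
        congrFun (congrFun map_aeval_freeZ a) a
      rw [map_sub, map_mul, map_one, h2, MvPolynomial.aeval_X, omegaMat_apply, omegaEntry_self]
      change _ * ((_⁻¹ : (LambdaHat n)ˣ) : LambdaHat n) - 1 = 0
      rw [Units.mul_inv, sub_self]
  exact fun f hf => h1 hf

/-- The homomorphism `𝒪(𝒵̃) → Λ̂` sending `Z` to `Ω(1 - A|y)`. -/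
noncomputable def centralizerHom (n : ℕ) : OZ n →ₐ[RT n] LambdaHat n :=
  Ideal.Quotient.liftₐ (relZ n) (MvPolynomial.aeval (genImage n)) relZ_le_ker

theorem map_centralizerHom_matZ : (matZ n).map (centralizerHom n) = omegaMat n :=
  map_aeval_freeZ

theorem centralizerHom_sigmaFun {m : ℕ} (hm : m ≤ n) :
    centralizerHom n (sigmaFun m hm) = leadingMinor (omegaMat n * matP' n) m hm := by
  have h1 : ((matP n).map (algebraMap (RT n) (OZ n))).map (centralizerHom n) = matP' n := by
    ext1 a b
    exact (centralizerHom n).commutes _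
  rw [sigmaFun]
  refine (map_leadingMinor (centralizerHom n).toRingHom _ hm).trans ?_
  change leadingMinor (Matrix.map _ (centralizerHom n)) m hm = _
  rw [Matrix.map_mul, map_centralizerHom_matZ, h1]

theorem centralizerHom_tauFun {m : ℕ} (hm : m ≤ n) :
    centralizerHom n (tauFun m hm) = leadingMinor (omegaMat n * matA' n * matP' n) m hm := by
  have h1 : ((matP n).map (algebraMap (RT n) (OZ n))).map (centralizerHom n) = matP' n := by
    ext1 a b
    exact (centralizerHom n).commutes _
  have h2 : ((matA n).map (algebraMap (RT n) (OZ n))).map (centralizerHom n) = matA' n := by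
    ext1 a b
    exact (centralizerHom n).commutes _
  rw [tauFun]
  refine (map_leadingMinor (centralizerHom n).toRingHom _ hm).trans ?_
  change leadingMinor (Matrix.map _ (centralizerHom n)) m hm = _
  rw [Matrix.map_mul, Matrix.map_mul, map_centralizerHom_matZ, h1, h2]

/-- Times the Vandermonde determinant, both sides are the bialternant with `φ_j = Ω(b_j|y)`. -/
theorem omegaProd_mul_kSchurClosedPart [NeZero n] (hn : 2 ≤ n) {i : ℕ} (hi : 1 ≤ i) (hin : i ≤ n) :
    (omegaProd n (n - i) : LambdaHat n) * kSchurClosedPart (kRect n i) =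
      centralizerHom n (sigmaFun (n - i) (Nat.sub_le n i)) := by
  have him : i + (n - i) = n := Nat.add_sub_cancel' hin
  refine mul_right_cancel₀ (det_bialternant_one_ne_zero hn i (n - i)) ?_
  have h1 := omegaProd_mul_foldr_mul_det hn hi him (ψ := fun _ => 1) (fun w j => map_one _)
  simp only [prod_const_one, mul_one] at h1
  rw [centralizerHom_sigmaFun, leadingMinor_mul_det i _ omegaMat_mulVec_newton, ← h1,
    (kSchurPart_kRect hn hi hin).1]

/-- Here `φ_j = Ω(b_j|y) e^{-a_j}`: the extra factor is the eigenvalue of `A` on one side, and on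
the other comes from the passage from `T` to `D`. -/
theorem omegaProd_mul_kSchurPart [NeZero n] (hn : 2 ≤ n) {i : ℕ} (hi : 1 ≤ i) (hin : i ≤ n) :
    (omegaProd n (n - i) : LambdaHat n) *
        ((∏ s ∈ range (n - i), xElt ((i : ZMod n) - (s : ZMod n))) * kSchurPart (kRect n i)) =
      centralizerHom n (tauFun (n - i) (Nat.sub_le n i)) := by
  have him : i + (n - i) = n := Nat.add_sub_cancel' hin
  refine mul_right_cancel₀ (det_bialternant_one_ne_zero hn i (n - i)) ?_
  have h1 := omegaProd_mul_foldr_mul_det hn hi him (ψ := xElt) permHom_xElt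
  rw [centralizerHom_tauFun, leadingMinor_mul_det i _ omegaMat_mul_matA'_mulVec_newton, ← h1,
    (kSchurPart_kRect hn hi hin).2, prod_xElt_mul_foldr_demazureT hn him, mul_one]

theorem ex_sum {ι : Type*} (s : Finset ι) (μ : ι → Weight n) :
    ex (∑ k ∈ s, μ k) = ∏ k ∈ s, ex (μ k) := by
  classical
  induction s using Finset.induction_on with
  | empty => rw [sum_empty, prod_empty, ex_zero]
  | insert a s ha ih => rw [sum_insert ha, prod_insert ha, ex_add, ih]

end KkSchur

theorem mainTheorem6 (n : ℕ) [NeZero n] (hn : 2 ≤ n) :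
    ∃ β : KkSchur.OZ n →ₐ[KkSchur.RT n] KkSchur.LambdaHat n,
      (∀ i j : Fin n, i ≤ j →
        β (KkSchur.matZ n i j) = KkSchur.zImage ((i : ℕ) + 1) ((j : ℕ) + 1)) ∧
      ∀ i : ℕ, 1 ≤ i → i ≤ n →
        KkSchur.kSchurClosedPart (KkSchur.kRect n i) =
          β (KkSchur.sigmaFun (n - i) (Nat.sub_le n i)) *
            ((KkSchur.xi (KkSchur.kRect n i))⁻¹).val ∧
        KkSchur.kSchurPart (KkSchur.kRect n i) =
          KkSchur.ex (∑ s ∈ Finset.range (n - i), KkSchur.wt ((i : ZMod n) - (s : ZMod n))) •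
            (β (KkSchur.tauFun (n - i) (Nat.sub_le n i)) *
              ((KkSchur.xi (KkSchur.kRect n i))⁻¹).val) := by
  refine ⟨KkSchur.centralizerHom n, fun i j hij => ?_, fun i hi hin => ⟨?_, ?_⟩⟩
  · have h1 : (i : ℕ) ≤ j := hij
    rw [KkSchur.zImage_eq_omegaEntry hn (by omega) (by omega), ← KkSchur.omegaMat_apply,
      ← KkSchur.map_centralizerHom_matZ, Matrix.map_apply]
  · rw [KkSchur.xi_kRect hi, Units.eq_mul_inv_iff_mul_eq, mul_comm,
      KkSchur.omegaProd_mul_kSchurClosedPart hn hi hin]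
  · have h1 : KkSchur.ex (∑ s ∈ Finset.range (n - i), KkSchur.wt ((i : ZMod n) - (s : ZMod n))) •
        (∏ s ∈ Finset.range (n - i), KkSchur.xElt ((i : ZMod n) - (s : ZMod n))) = 1 := by
      simp only [KkSchur.xElt]
      rw [← map_prod, ← KkSchur.ex_sum, Algebra.smul_def, ← map_mul, ← KkSchur.ex_add,
        Finset.sum_neg_distrib, add_neg_cancel, KkSchur.ex_zero, map_one]
    rw [KkSchur.xi_kRect hi, ← KkSchur.omegaProd_mul_kSchurPart hn hi hin, mul_right_comm,
      Units.mul_inv, one_mul, ← smul_mul_assoc, h1, one_mul]
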